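/- **Theorem 3.1 (generalized Hadamard jump condition).** Let $d\ge 2$. *Conventions.* A domain is a nonempty connected open subset of $\mathbb{R}^d$. It is of class $C^1$ if for each $\xi\in\partial\Omega$ there are $r>0$, Cartesian coordinates $(\bar x,x_d)\in\mathbb{R}^{d-1}\times\mathbb{R}$ and a $C^1$ function $g:\mathbb{R}^{d-1}\to\mathbb{R}$ with $\Omega\cap B(\xi,r)=\{x\in B(\xi,r): x_d>g(\bar x)\}$ and $\partial\Omega\cap B(\xi,r)=\{x\in B(\xi,r): x_d=g(\bar x)\}$. A $(d-1)$-surface of class $C^1$ is a relatively compact set $\Gamma\subset\mathbb{R}^d$ such that for each $\xi\in\Gamma$ there are $r>0$, Cartesian coordinates $(\bar x,x_d)$ and a $C^1$ function $g:\mathbb{R}^{d-1}\to\mathbb{R}$ with $\Gamma\cap B(\xi,r)=\{x\in B(\xi,r): x_d=g(\bar x)\}$. For $U$ open, $y\in C^1(\overline U,\mathbb{R}^d)$ means that $y$ extends to a continuously differentiable map on an open set containing $\overline U$; at points of $\overline U$, $Dy$ denotes the derivative of such an extension (it does not depend on the choice). $W^{1,\infty}(\Omega,\mathbb{R}^d)$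 is the space of maps in $L^\infty(\Omega,\mathbb{R}^d)$ whose weak derivative $Dz$ is in $L^\infty$. Finally, $(a\otimes n)v=(n\cdot v)\,a$. *Statement.* Let $\Omega\subset\mathbb{R}^d$ be a bounded $C^1$ domain and suppose that $\Omega=\Omega^+\cup\Gamma\cup\Omega^-$, where $\Omega^+,\Omega^-$ are disjoint open sets and $\Gamma=\Omega\cap\partial\Omega^+=\Omega\cap\partial\Omega^-$ is a $(d-1)$-surface of class $C^1$. Let $y^\pm\in C^1(\overline{\Omega^\pm},\mathbb{R}^d)$ and let $n\in C(\Gamma,\mathbb{R}^d)$ be the outward unit normal to $\Gamma$ with respect to $\Omega^+$. If there exists a map $z\in W^{1,\infty}(\Omega,\mathbb{R}^d)$ such that $$Dz(x)=\begin{cases}Dy^+(x), & \text{for a.e. } x\in\Omega^+,\\ Dy^-(x), & \text{for a.e. } x\in\Omega^-,\end{cases}\tag{1}$$ then for some $a\in C(\Gamma,\mathbb{R}^d)$ and all $x\in\Gamma$, $$Dy^+(x)=Dy^-(x)+a(x)\otimes n(x).\tag{2}$$ Conversely, suppose that $\Gamma$ is connected (possibly empty) or that $\Omega$ is simply connected.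 If (2) holds for all $x\in\Gamma$ with some $a\in C(\Gamma,\mathbb{R}^d)$, then there exists a map $z\in W^{1,\infty}(\Omega,\mathbb{R}^d)$ satisfying (1). -/

import Mathlib

open MeasureTheory Set Filter Topology
open scoped ContDiff ENNReal

noncomputable section

namespace HadamardJump

/-- Euclidean space of dimension `d`. -/
abbrev Euc (d : ℕ) : Type := EuclideanSpace ℝ (Fin d)

/-- A Cartesian coordinate system on `ℝ^d`, i.e. a surjective isometry that assigns to each point
`x` its coordinates `(x̄, x_d)`, where `x̄ ∈ ℝ^(d-1)` is `(T x).fst` and `x_d ∈ ℝ` is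
`(T x).snd`. -/
abbrev Cartesian (d : ℕ) : Type := Euc d ≃ᵃⁱ[ℝ] WithLp 2 (Euc (d - 1) × ℝ)

/-- A domain (open and connected set) of class `C¹`: near each of its boundary points, in suitable
Cartesian coordinates, it is the set of points above the graph of a `C¹` function, and its
boundary is the graph. -/
structure IsC1Domain {d : ℕ} (Ω : Set (Euc d)) : Prop where
  isOpen : IsOpen Ω
  isConnected : IsConnected Ω
  boundary : ∀ ξ ∈ frontier Ω, ∃ r : ℝ, 0 < r ∧ ∃ (T : Cartesian d) (g : Euc (d - 1) → ℝ),
    ContDiff ℝ 1 g ∧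
    Ω ∩ Metric.ball ξ r = {x ∈ Metric.ball ξ r | g (T x).fst < (T x).snd} ∧
    frontier Ω ∩ Metric.ball ξ r = {x ∈ Metric.ball ξ r | (T x).snd = g (T x).fst}

/-- A `(d-1)`-surface of class `C¹` in `ℝ^d`: a relatively compact set which near each of its
points is, in suitable Cartesian coordinates, the graph of a `C¹` function. (With the subspace
topology, each of its points then has an open neighbourhood homeomorphic to a ball of `ℝ^(d-1)`,
so that it is an embedded manifold without boundary points of its own.) -/
structure IsC1Surface {d : ℕ} (Γ : Set (Euc d)) : Prop where
  relativelyCompact : IsCompact (closure Γ)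
  graph : ∀ ξ ∈ Γ, ∃ r : ℝ, 0 < r ∧ ∃ (T : Cartesian d) (g : Euc (d - 1) → ℝ),
    ContDiff ℝ 1 g ∧
    Γ ∩ Metric.ball ξ r = {x ∈ Metric.ball ξ r | (T x).snd = g (T x).fst}

/-- `y ∈ C¹(closure U, ℝ^d)`: the map `y` is continuously differentiable on an open set containing
the closure of `U`. (A map given on `U` only is represented by any of its extensions; as `U` is
open, the derivative at the points of `closure U` does not depend on the extension.) -/
def IsC1UpToBoundary {d : ℕ} (U : Set (Euc d)) (y : Euc d → Euc d) : Prop :=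
  ∃ V : Set (Euc d), IsOpen V ∧ closure U ⊆ V ∧ ContDiffOn ℝ 1 y V

/-- `ν` is the outward unit normal at `x` to the surface `Γ` with respect to `U`: a unit vector
orthogonal to all the tangent vectors of `Γ` at `x`, which points out of `U`. -/
structure IsOutwardUnitNormal {d : ℕ} (U Γ : Set (Euc d)) (x ν : Euc d) : Prop where
  norm_eq_one : ‖ν‖ = 1
  orthogonal : ∀ v ∈ tangentConeAt ℝ Γ x, inner ℝ ν v = 0
  outward : ∀ᶠ t : ℝ in 𝓝[>] 0, x - t • ν ∈ U ∧ x + t • ν ∉ U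

/-- The locally integrable field `G` is the weak (distributional) derivative of the locally
integrable map `z` on the open set `Ω`. -/
structure HasWeakDeriv {d : ℕ} (Ω : Set (Euc d)) (z : Euc d → Euc d)
    (G : Euc d → Euc d →L[ℝ] Euc d) : Prop where
  locallyIntegrable : LocallyIntegrableOn z Ω volume
  locallyIntegrable_deriv : LocallyIntegrableOn G Ω volume
  integral_eq : ∀ φ : Euc d → ℝ, ContDiff ℝ ∞ φ → HasCompactSupport φ → tsupport φ ⊆ Ω →
    ∀ v : Euc d, ∫ x in Ω, (fderiv ℝ φ x v) • z x = - ∫ x in Ω, φ x • G x v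

/-- The Sobolev space `W^{1,∞}(Ω, ℝ^d)`. -/
def MemW1Infty {d : ℕ} (Ω : Set (Euc d)) (z : Euc d → Euc d) : Prop :=
  MemLp z ∞ (volume.restrict Ω) ∧
    ∃ G : Euc d → Euc d →L[ℝ] Euc d, MemLp G ∞ (volume.restrict Ω) ∧ HasWeakDeriv Ω z G

/-- The weak derivative of `z` on `Ω` is `Dy⁺` (a.e.) on `Ω⁺` and `Dy⁻` (a.e.) on `Ω⁻`. -/
def WeakDerivPiecewise {d : ℕ} (Ω Ωp Ωm : Set (Euc d)) (yp ym z : Euc d → Euc d) : Prop :=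
  ∃ Dz : Euc d → Euc d →L[ℝ] Euc d, HasWeakDeriv Ω z Dz ∧
    (∀ᵐ x ∂(volume.restrict Ωp), Dz x = fderiv ℝ yp x) ∧
    (∀ᵐ x ∂(volume.restrict Ωm), Dz x = fderiv ℝ ym x)

/-- The jump condition `Dy⁺ = Dy⁻ + a ⊗ n` on `Γ`, for some continuous `a : Γ → ℝ^d`. Here
`a ⊗ n` is the linear map `v ↦ (n · v) a`. -/
def JumpCondition {d : ℕ} (Γ : Set (Euc d)) (yp ym n : Euc d → Euc d) : Prop :=
  ∃ a : Euc d → Euc d, ContinuousOn a Γ ∧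
    ∀ x ∈ Γ, fderiv ℝ yp x = fderiv ℝ ym x + InnerProductSpace.rankOne ℝ (a x) (n x)

end HadamardJump

end

noncomputable section

namespace HadamardJump

/-! ### Mean value inequality under pointwise Lipschitz bounds. -/

section Slope

variable {E F : Type*} [NormedAddCommGroup E] [NormedAddCommGroup F]

/-! Necessity is a blow-up argument. A weak gradient is curl-free in the sense of distributions,
because second derivatives of test functions commute (`HasWeakDeriv.integral_fderiv_smul_comm`).
Rescaling around `ξ ∈ Γ` preserves this (`curl_free_blow_up`), and since `Γ` is flat at `ξ` to first
order, the limit field is `Dy⁺(ξ)` on the half-space `n · y < 0` and `Dy⁻(ξ)` on the opposite one.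
Testing such a field with a radial bump shows that both matrices agree on vectors orthogonal to `n`
(`apply_eq_of_curl_free_half_space`), so their difference is `a ⊗ n` with `a = (Dy⁺ - Dy⁻) n`.

For the converse, the jump condition makes the tangential derivative of `y⁺ - y⁻` vanish, so `y⁺ -
y⁻` is locally constant on `Γ`. If `Γ` is connected it is a constant `c`, and `z` is `y⁺` on one
side and `y⁻ + c` on the other. If `Ω` is simply connected, such primitives exist locally, differ by
locally constant maps, and are glued by lifting the identity to a covering space
(`exists_glue_modulo_locally_constant`). The resulting `z` satisfies one Lipschitz estimate at every
point; with the `C¹` boundary this bounds `z`, and since `Γ` is null its classical derivative is its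
weak derivative. -/

theorem continuousAt_of_eventually_norm_sub_le {f : E → F} {C : ℝ} {x : E}
    (hf : ∀ᶠ y in 𝓝 x, ‖f y - f x‖ ≤ C * ‖y - x‖) : ContinuousAt f x := by
  rw [ContinuousAt, tendsto_iff_norm_sub_tendsto_zero]
  refine squeeze_zero' (Eventually.of_forall fun _ => norm_nonneg _) hf ?_
  have : Continuous fun y : E => C * ‖y - x‖ := by fun_prop
  simpa using this.tendsto x

variable [NormedSpace ℝ E]

/-- Only right slopes of `t ↦ ‖f (l t) - f a‖` enter, so no derivative of `f` is needed. This suits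
the glued map `z`, which may fail to be differentiable on `Γ`. -/
theorem norm_sub_le_of_eventually_on_segment {f : E → F} {C : ℝ} {a b : E}
    (hf : ∀ x ∈ segment ℝ a b, ∀ᶠ y in 𝓝 x, ‖f y - f x‖ ≤ C * ‖y - x‖) :
    ‖f b - f a‖ ≤ C * ‖b - a‖ := by
  let l : ℝ → E := fun t => AffineMap.lineMap a b t
  have hl : Continuous l := AffineMap.lineMap_continuous
  have hmem : ∀ t ∈ Icc (0 : ℝ) 1, l t ∈ segment ℝ a b := fun t ht => by
    rw [segment_eq_image_lineMap]; exact ⟨t, ht, rfl⟩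
  have hls : ∀ s t, l s - l t = (s - t) • (b - a) := fun s t => by
    simp only [l, AffineMap.lineMap_apply_module']
    module
  have key := image_le_of_liminf_slope_right_le_deriv_boundary (a := 0) (b := 1)
    (f := fun t => ‖f (l t) - f a‖) (B := fun t => C * ‖b - a‖ * t)
    (B' := fun _ => C * ‖b - a‖) ?_ (by simp [l]) (by fun_prop) ?_ ?_
    (right_mem_Icc.2 zero_le_one)
  · simpa [l] using key
  · intro t ht
    have := (continuousAt_of_eventually_norm_sub_le (hf _ (hmem t ht))).comp hl.continuousAt
    exact (this.sub continuousAt_const).norm.continuousWithinAt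
  · intro t _
    simpa using ((hasDerivAt_id t).const_mul (C * ‖b - a‖)).hasDerivWithinAt
  · intro t ht r hr
    have h1 := hl.continuousAt.eventually (hf _ (hmem t ⟨ht.1, ht.2.le⟩))
    refine Eventually.frequently ?_
    filter_upwards [h1.filter_mono nhdsWithin_le_nhds, self_mem_nhdsWithin] with s hs hts
    have hts : t < s := hts
    refine lt_of_le_of_lt ?_ hr
    rw [slope_def_field, div_le_iff₀ (sub_pos.2 hts)]
    rw [hls, norm_smul, Real.norm_of_nonneg (sub_pos.2 hts).le] at hs
    have := norm_sub_norm_le (f (l s) - f a) (f (l t) - f a)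
    rw [sub_sub_sub_cancel_right] at this
    linarith

theorem lipschitzWith_of_eventually_norm_sub_le {f : E → F} {C : NNReal}
    (hf : ∀ x, ∀ᶠ y in 𝓝 x, ‖f y - f x‖ ≤ C * ‖y - x‖) : LipschitzWith C f :=
  LipschitzWith.of_dist_le_mul fun a b => by
    rw [dist_eq_norm, dist_eq_norm]
    exact norm_sub_le_of_eventually_on_segment fun x _ => hf x

end Slope

/-! ### Gluing over a simply connected space. -/

section Gluing

variable {X F : Type*} [TopologicalSpace X] [AddCommGroup F]

/-- Local functions which differ by locally constant ones can be glued on a simply connected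
space, up to locally constant functions. -/
theorem exists_glue_modulo_locally_constant [SimplyConnectedSpace X] [LocallyPathConnectedSpace X]
    (U : X → Set X) (hU : ∀ i, IsOpen (U i)) (hUi : ∀ i, i ∈ U i) (s : X → X → F)
    (hs : ∀ i j, ∀ x ∈ U i ∩ U j, ∀ᶠ y in 𝓝 x, s i y - s j y = s i x - s j x) :
    ∃ z : X → F, ∀ i, ∀ x ∈ U i, ∀ᶠ y in 𝓝 x, z y - s i y = z x - s i x := by
  -- With discrete fibres the bundle is a covering, and continuity into `F` means local constancy.
  let _ : TopologicalSpace F := ⊥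
  have : DiscreteTopology F := ⟨rfl⟩
  -- The coordinate `v` over `x` in chart `i` encodes the candidate value `v + s i x` of the glued
  -- map, hence the transition by `s i x - s j x`.
  let Z : FiberBundleCore X X F :=
    { baseSet := U
      isOpen_baseSet := hU
      indexAt := id
      mem_baseSet_at := hUi
      coordChange := fun i j x v => v + (s i x - s j x)
      coordChange_self := fun i x _ v => by simp
      continuousOn_coordChange := fun i j => by
        rintro ⟨x, v⟩ ⟨hx, -⟩
        refine ContinuousAt.continuousWithinAt ?_
        rw [ContinuousAt, nhds_discrete F, tendsto_pure]
        have h1 : ∀ᶠ p : X × F in 𝓝 (x, v), p.2 = v := by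
          have := (continuous_snd (X := X) (Y := F)).tendsto (x, v)
          rwa [nhds_discrete F, tendsto_pure] at this
        filter_upwards [h1, continuousAt_fst.eventually (hs i j x hx)] with p hp1 hp2
        rw [hp1, hp2]
      coordChange_comp := fun i j k x _ v => by abel }
  have cov : IsCoveringMap Z.proj := FiberBundle.isCoveringMap
  obtain ⟨x₀⟩ : Nonempty X := inferInstance
  -- Simple connectedness enters here: the identity lifts to a global section.
  obtain ⟨f, ⟨-, hf⟩, -⟩ := cov.existsUnique_continuousMap_lifts (ContinuousMap.id X) x₀
    (⟨x₀, (0 : F)⟩ : Z.TotalSpace) rfl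
  have hfx : ∀ x, (f x).1 = x := fun x => congr_fun hf x
  let z : X → F := fun x => (show F from (f x).2) + s (f x).1 (f x).1
  refine ⟨z, fun i x hx => ?_⟩
  have hz : ∀ y, z y - s i y = (Z.localTriv i (f y)).2 := fun y => by
    rw [Z.localTriv_apply]
    change z y - s i y = (show F from (f y).2) + (s (f y).1 (f y).1 - s i (f y).1)
    rw [← add_sub_assoc]
    simp only [hfx, z]
  have hcont : ContinuousAt (fun y => (Z.localTriv i (f y)).2) x := by
    have h1 : ContinuousAt (Z.localTriv i) (f x) := by
      refine (Z.localTriv i).continuousAt ?_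
      rw [Z.mem_localTriv_source]
      change (f x).1 ∈ U i
      rwa [hfx]
    exact continuousAt_snd.comp (h1.comp f.continuous.continuousAt)
  rw [ContinuousAt, nhds_discrete F, tendsto_pure] at hcont
  filter_upwards [hcont] with y hy
  rw [hz, hz, hy]

end Gluing

end HadamardJump

namespace HadamardJump

/-! ### Local geometry of `C¹` surfaces. -/

section Surface

variable {d : ℕ} {Γ : Set (Euc d)}

/-- Here `γ` parametrizes the graph and `π` forgets the last coordinate. Lying on the graph becomes
`γ (π x) = x`, so later arguments need no coordinates. -/
theorem Cartesian.exists_graph_param (T : Cartesian d) {g : Euc (d - 1) → ℝ}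
    (hg : ContDiff ℝ 1 g) :
    ∃ (γ : Euc (d - 1) → Euc d) (π : Euc d → Euc (d - 1)), ContDiff ℝ 1 γ ∧ LipschitzWith 1 π ∧
      (∀ v, π (γ v) = v) ∧ ∀ x, (T x).snd = g (T x).fst ↔ γ (π x) = x := by
  refine ⟨fun v => T.symm (WithLp.toLp 2 (v, g v)), fun x => (T x).fst, ?_, ?_, ?_, ?_⟩
  · exact T.symm.toAffineIsometry.toContinuousAffineMap.contDiff.comp
      ((WithLp.prodContinuousLinearEquiv 2 ℝ (Euc (d - 1)) ℝ).symm.contDiff.comp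
        (contDiff_id.prodMk hg))
  · refine LipschitzWith.of_dist_le_mul fun x y => ?_
    rw [NNReal.coe_one, one_mul, ← T.dist_map, dist_eq_norm, dist_eq_norm]
    exact WithLp.norm_fst_le _ (T x - T y)
  · intro v
    simp
  · intro x
    constructor
    · intro h
      simp only
      rw [← h]
      exact T.symm_apply_apply x
    · intro h
      simp only at h
      have h2 := congrArg T h
      rw [T.apply_symm_apply] at h2
      have h3 : T x = WithLp.toLp 2 ((T x).fst, g (T x).fst) := h2.symm
      have := congrArg (fun p : WithLp 2 (Euc (d - 1) × ℝ) => p.snd) h3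
      simpa using this

theorem IsC1Surface.exists_param (hΓ : IsC1Surface Γ) {ξ : Euc d} (hξ : ξ ∈ Γ) :
    ∃ (γ : Euc (d - 1) → Euc d) (π : Euc d → Euc (d - 1)), ContDiff ℝ 1 γ ∧ LipschitzWith 1 π ∧
      (∀ v, π (γ v) = v) ∧ ∃ r > 0, ∀ x ∈ Metric.ball ξ r, x ∈ Γ ↔ γ (π x) = x := by
  obtain ⟨r, hr, T, g, hg, h⟩ := hΓ.graph ξ hξ
  obtain ⟨γ, π, h1, h2, h3, h4⟩ := T.exists_graph_param hg
  refine ⟨γ, π, h1, h2, h3, r, hr, fun x hx => ?_⟩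
  rw [← h4]
  have := Set.ext_iff.1 h x
  simp only [mem_inter_iff, hx, and_true, mem_ofPred_eq, true_and] at this
  exact this

/-- A `C¹` image of `ℝ^(d-1)` has Hausdorff dimension at most `d - 1 < d`, and `d`-dimensional
Hausdorff measure is a Haar measure. -/
theorem volume_range_eq_zero_of_contDiff (hd : d ≠ 0) {γ : Euc (d - 1) → Euc d}
    (hγ : ContDiff ℝ 1 γ) : volume (range γ) = 0 := by
  have h1 : dimH (range γ) < ((d : NNReal) : ℝ≥0∞) := by
    refine hγ.dimH_range_le.trans_lt ?_
    simp only [finrank_euclideanSpace_fin, ENNReal.coe_natCast]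
    exact_mod_cast Nat.sub_lt (Nat.pos_of_ne_zero hd) one_pos
  have h2 := hausdorffMeasure_of_dimH_lt h1
  have h3 : Measure.IsAddHaarMeasure (Measure.hausdorffMeasure (X := Euc d) (d : ℝ)) := by
    simpa using isAddHaarMeasure_hausdorffMeasure (E := Euc d)
  rw [NNReal.coe_natCast] at h2
  exact Measure.absolutelyContinuous_isAddHaarMeasure _ _ h2

theorem IsC1Surface.volume_eq_zero (hΓ : IsC1Surface Γ) (hd : d ≠ 0) : volume Γ = 0 := by
  refine measure_null_of_locally_null Γ fun ξ hξ => ?_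
  obtain ⟨γ, π, h1, -, -, r, hr, h⟩ := hΓ.exists_param hξ
  refine ⟨Γ ∩ Metric.ball ξ r, inter_mem_nhdsWithin _ (Metric.ball_mem_nhds _ hr),
    measure_mono_null ?_ (volume_range_eq_zero_of_contDiff hd h1)⟩
  rintro x ⟨hx, hxr⟩
  exact ⟨π x, (h x hxr).1 hx⟩

theorem fderiv_mem_tangentConeAt {γ : Euc (d - 1) → Euc d} {v : Euc (d - 1)}
    (hγ : DifferentiableAt ℝ γ v) (h : ∀ᶠ w in 𝓝 v, γ w ∈ Γ) (u : Euc (d - 1)) :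
    fderiv ℝ γ v u ∈ tangentConeAt ℝ Γ (γ v) := by
  have h1 := (hγ.hasFDerivAt.hasFDerivWithinAt (s := {w | γ w ∈ Γ})).mapsTo_tangent_cone
  have h2 : u ∈ tangentConeAt ℝ {w | γ w ∈ Γ} v := by
    rw [tangentConeAt_of_mem_nhds h]; trivial
  exact tangentConeAt_mono (image_subset_iff.2 fun _ hw => hw) (h1 h2)

/-- Near each of its points a `C¹` surface is flat in the direction of the normal. -/
theorem IsC1Surface.eventually_inner_normal_le (hΓ : IsC1Surface Γ) {ξ ν : Euc d} (hξ : ξ ∈ Γ)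
    (hν : ∀ v ∈ tangentConeAt ℝ Γ ξ, inner ℝ ν v = 0) {ε : ℝ} (hε : 0 < ε) :
    ∀ᶠ p in 𝓝 ξ, p ∈ Γ → |inner ℝ ν (p - ξ)| ≤ ε * ‖p - ξ‖ := by
  obtain ⟨γ, π, h1, h2, h3, r, hr, h⟩ := hΓ.exists_param hξ
  have hγξ : γ (π ξ) = ξ := (h ξ (Metric.mem_ball_self hr)).1 hξ
  have hdiff : DifferentiableAt ℝ γ (π ξ) := h1.differentiable one_ne_zero _
  have hmem : ∀ᶠ w in 𝓝 (π ξ), γ w ∈ Γ := by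
    have : ∀ᶠ w in 𝓝 (π ξ), γ w ∈ Metric.ball ξ r := by
      refine h1.continuous.continuousAt.eventually ?_
      rw [hγξ]; exact Metric.ball_mem_nhds _ hr
    filter_upwards [this] with w hw
    rw [h _ hw, h3]
  have hε' : 0 < ε / (‖ν‖ + 1) := by positivity
  have h4 := hdiff.hasFDerivAt.isLittleO.def hε'
  filter_upwards [h2.continuous.continuousAt.eventually h4, Metric.ball_mem_nhds ξ hr]
    with p hp hpr hpΓ
  rw [(h p hpr).1 hpΓ, hγξ] at hp
  have h5 : inner ℝ ν (fderiv ℝ γ (π ξ) (π p - π ξ)) = 0 := by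
    refine hν _ ?_
    have := fderiv_mem_tangentConeAt hdiff hmem (π p - π ξ)
    rwa [hγξ] at this
  -- Subtracting a tangent vector does not change the product with `ν`, and leaves only the Taylor
  -- remainder of `γ`.
  have h6 : inner ℝ ν (p - ξ) = inner ℝ ν (p - ξ - fderiv ℝ γ (π ξ) (π p - π ξ)) := by
    rw [inner_sub_right _ (p - ξ), h5, sub_zero]
  have h7 : ‖π p - π ξ‖ ≤ ‖p - ξ‖ := by
    simpa [dist_eq_norm] using h2.dist_le_mul p ξ
  rw [h6]
  calc _ ≤ ‖ν‖ * ‖p - ξ - fderiv ℝ γ (π ξ) (π p - π ξ)‖ := abs_real_inner_le_norm _ _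
    _ ≤ (‖ν‖ + 1) * (ε / (‖ν‖ + 1) * ‖p - ξ‖) := by
      have h8 := hp.trans (mul_le_mul_of_nonneg_left h7 hε'.le)
      gcongr
      linarith
    _ = ε * ‖p - ξ‖ := by field_simp

/-- A `C¹` function whose tangential derivative vanishes on a `C¹` surface is locally constant
there. -/
theorem IsC1Surface.eventually_eq_of_tangential_fderiv_eq_zero (hΓ : IsC1Surface Γ)
    {F : Type*} [NormedAddCommGroup F] [NormedSpace ℝ F] {u : Euc d → F}
    (hu : ∀ x ∈ Γ, DifferentiableAt ℝ u x)
    (hut : ∀ x ∈ Γ, ∀ v ∈ tangentConeAt ℝ Γ x, fderiv ℝ u x v = 0) {ξ : Euc d} (hξ : ξ ∈ Γ) :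
    ∀ᶠ p in 𝓝 ξ, p ∈ Γ → u p = u ξ := by
  obtain ⟨γ, π, h1, h2, h3, r, hr, h⟩ := hΓ.exists_param hξ
  have hγξ : γ (π ξ) = ξ := (h ξ (Metric.mem_ball_self hr)).1 hξ
  have hO : IsOpen (γ ⁻¹' Metric.ball ξ r) := Metric.isOpen_ball.preimage h1.continuous
  have hmem : ∀ w ∈ γ ⁻¹' Metric.ball ξ r, γ w ∈ Γ := fun w hw => by rw [h _ hw, h3]
  obtain ⟨δ, hδ, hball⟩ := Metric.isOpen_iff.1 hO (π ξ)
    (by rw [mem_preimage, hγξ]; exact Metric.mem_ball_self hr)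
  have hderiv : ∀ w ∈ Metric.ball (π ξ) δ, HasFDerivAt (u ∘ γ) (0 : Euc (d - 1) →L[ℝ] F) w := by
    intro w hw
    have hγw := h1.differentiable one_ne_zero w
    have h4 := (hu _ (hmem w (hball hw))).hasFDerivAt.comp w hγw.hasFDerivAt
    have h5 : (fderiv ℝ u (γ w)).comp (fderiv ℝ γ w) = 0 := by
      refine ContinuousLinearMap.ext fun v => hut _ (hmem w (hball hw)) _
        (fderiv_mem_tangentConeAt hγw ?_ v)
      filter_upwards [hO.mem_nhds (hball hw)] with w' hw' using hmem w' hw'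
    rwa [h5] at h4
  filter_upwards [h2.continuous.continuousAt.eventually (Metric.ball_mem_nhds _ hδ),
    Metric.ball_mem_nhds ξ hr] with p hp hpr hpΓ
  have h5 := (convex_ball (π ξ) δ).norm_image_sub_le_of_norm_hasFDerivWithin_le (C := 0)
    (fun w hw => (hderiv w hw).hasFDerivWithinAt) (fun w _ => by simp)
    (Metric.mem_ball_self hδ) hp
  rw [zero_mul, norm_le_zero_iff, sub_eq_zero] at h5
  simpa [(h p hpr).1 hpΓ, hγξ] using h5

end Surface

end HadamardJump

namespace HadamardJump

/-! ### Blow-up and curl-free fields on half-spaces. -/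

section HalfSpace

variable {E F : Type*} [NormedAddCommGroup E] [InnerProductSpace ℝ E]
  [NormedAddCommGroup F] [NormedSpace ℝ F]

/-- For `φ = σ (1 - ‖y‖²)` the gradient is `-q(y) y` with `q ≥ 0` radial: parity and reflection then
evaluate its integrals. The last clause makes the integral in the normal direction nonzero. -/
theorem exists_radial_bump [FiniteDimensional ℝ E] :
    ∃ φ q : E → ℝ, ContDiff ℝ ∞ φ ∧ HasCompactSupport φ ∧ Continuous q ∧ HasCompactSupport q ∧
      (∀ y, 0 ≤ q y) ∧ (∀ y y', ‖y‖ = ‖y'‖ → q y = q y') ∧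
      (∀ y v, fderiv ℝ φ y v = -(q y * inner ℝ y v)) ∧
      ∀ ν : E, ‖ν‖ = 1 → ∃ s > (0 : ℝ), 0 < q (-(s • ν)) := by
  let σ := Real.smoothTransition
  have hσ : ContDiff ℝ ∞ σ := Real.smoothTransition.contDiff
  have hσd : Differentiable ℝ σ := hσ.differentiable (by simp)
  have hσ0 : ∀ s < 0, deriv σ s = 0 := fun s hs => by
    have : σ =ᶠ[𝓝 s] fun _ => 0 := by
      filter_upwards [Iio_mem_nhds hs] with t ht
      exact Real.smoothTransition.zero_of_nonpos (le_of_lt ht)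
    rw [this.deriv_eq, deriv_const]
  refine ⟨fun y => σ (1 - ‖y‖ ^ 2), fun y => 2 * deriv σ (1 - ‖y‖ ^ 2), ?_, ?_, ?_, ?_, ?_, ?_,
    ?_, ?_⟩
  · exact hσ.comp (contDiff_const.sub (contDiff_norm_sq ℝ))
  · refine HasCompactSupport.intro (isCompact_closedBall (0 : E) 1) fun y hy => ?_
    have : 1 < ‖y‖ := by simpa using hy
    exact Real.smoothTransition.zero_of_nonpos (by nlinarith)
  · have := hσ.continuous_deriv (by simp)
    fun_prop
  · refine HasCompactSupport.intro (isCompact_closedBall (0 : E) 1) fun y hy => ?_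
    have : 1 < ‖y‖ := by simpa using hy
    rw [hσ0 _ (by nlinarith), mul_zero]
  · intro y
    exact mul_nonneg zero_le_two (Real.smoothTransition.monotone.deriv_nonneg)
  · intro y y' h
    simp only [h]
  · intro y v
    have h1 := ((hasStrictFDerivAt_norm_sq y).hasFDerivAt.const_sub 1)
    have h2 := (hσd (1 - ‖y‖ ^ 2)).hasDerivAt.comp_hasFDerivAt y h1
    have h3 : fderiv ℝ (fun y : E => σ (1 - ‖y‖ ^ 2)) y = _ := h2.fderiv
    rw [h3]
    simp
    ring
  · intro ν hν
    -- `σ` rises from 0 to 1 on the unit interval, so its derivative equals 1 at some `c`; `s = √(1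
    -- - c)` gives `1 - s² = c`.
    obtain ⟨c, hc, hc'⟩ := exists_deriv_eq_slope σ zero_lt_one hσ.continuous.continuousOn
      hσd.differentiableOn
    refine ⟨√(1 - c), Real.sqrt_pos.2 (by linarith [hc.2]), ?_⟩
    change 0 < 2 * deriv σ (1 - ‖-(√(1 - c) • ν)‖ ^ 2)
    rw [norm_neg, norm_smul, hν, mul_one, Real.norm_of_nonneg (Real.sqrt_nonneg _),
      Real.sq_sqrt (by linarith [hc.2]), sub_sub_cancel, hc']
    simp [σ]

variable [FiniteDimensional ℝ E] [MeasurableSpace E] [BorelSpace E]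

/-- A field equal to `A` on a half-space and to `B` on the complement which is curl-free in the
sense of distributions jumps only in the normal direction. -/
theorem apply_eq_of_curl_free_half_space [CompleteSpace F] {A B : E →L[ℝ] F} {ν : E} (hν : ‖ν‖ = 1)
    (h : ∀ φ : E → ℝ, ContDiff ℝ ∞ φ → HasCompactSupport φ → ∀ v w : E,
      ∫ y, fderiv ℝ φ y v • (if inner ℝ ν y < 0 then A else B) w =
        ∫ y, fderiv ℝ φ y w • (if inner ℝ ν y < 0 then A else B) v)
    {w : E} (hw : inner ℝ ν w = 0) : A w = B w := by
  obtain ⟨φ, q, hφ, hφc, hq, hqc, hq0, hqr, hφq, hqν⟩ := exists_radial_bump (E := E)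
  let H : Set E := {y | inner ℝ ν y < 0}
  have hH : MeasurableSet H := (isOpen_lt (by fun_prop) continuous_const).measurableSet
  let f : E → E → ℝ := fun v y => q y * inner ℝ y v
  have hfi : ∀ v, Integrable (f v) := fun v =>
    Continuous.integrable_of_hasCompactSupport (by fun_prop) hqc.mul_right
  -- `f v` is odd, so a constant field contributes nothing and only the jump `A - B` over the
  -- half-space survives.
  have hf0 : ∀ v, ∫ y, f v y = 0 := fun v => by
    have h1 := integral_neg_eq_self (f v) volume
    have h2 : ∀ y, f v (-y) = - f v y := fun y => by
      simp [f, hqr (-y) y (norm_neg y)]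
    simp only [h2, integral_neg] at h1
    linarith
  have hint : ∀ v u, ∫ y, fderiv ℝ φ y v • (if inner ℝ ν y < 0 then A else B) u =
      -((∫ y, H.indicator (f v) y) • (A u - B u)) := fun v u => by
    have h1 : ∀ y, fderiv ℝ φ y v • (if inner ℝ ν y < 0 then A else B) u =
        -(f v y • B u + H.indicator (f v) y • (A u - B u)) := fun y => by
      rw [hφq]
      by_cases hy : inner ℝ ν y < 0
      · rw [indicator_of_mem (show y ∈ H from hy), if_pos hy]
        simp only [f]
        module
      · rw [indicator_of_notMem (show y ∉ H from hy), if_neg hy]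
        simp only [f]
        module
    simp only [h1]
    rw [integral_neg, integral_add ((hfi v).smul_const _)
      (((hfi v).indicator hH).smul_const _), integral_smul_const, integral_smul_const, hf0,
      zero_smul, zero_add]
  have hcw : ∫ y, H.indicator (f w) y = 0 := by
    -- This reflection fixes `ν`, hence the half-space, and changes the sign of `f w`.
    let R := (Submodule.span ℝ {w})ᗮ.reflection
    have hRw : R w = -w := Submodule.reflection_orthogonalComplement_singleton_eq_neg w
    have hRν : R ν = ν := Submodule.reflection_mem_subspace_eq_self
      (Submodule.mem_orthogonal_singleton_iff_inner_left.2 hw)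
    have h1 := R.measurePreserving.integral_comp R.toHomeomorph.measurableEmbedding
      (H.indicator (f w))
    have h2 : ∀ y, H.indicator (f w) (R y) = - H.indicator (f w) y := fun y => by
      have h3 : inner ℝ ν (R y) = inner ℝ ν y := by
        conv_lhs => rw [← hRν]
        exact R.inner_map_map _ _
      have h4 : inner ℝ (R y) w = - inner ℝ y w := by
        have : w = R (-w) := by rw [map_neg, hRw, neg_neg]
        conv_lhs => rw [this]
        rw [R.inner_map_map, inner_neg_right]
      simp only [indicator, H, mem_ofPred_eq, h3, f, h4, hqr (R y) y (R.norm_map y)]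
      split_ifs <;> ring
    simp only [h2, integral_neg] at h1
    linarith
  have hcν : ∫ y, H.indicator (f ν) y < 0 := by
    have h1 : ∀ y, H.indicator (f ν) y = -(q y * max (-inner ℝ y ν) 0) := fun y => by
      simp only [indicator, H, mem_ofPred_eq, f, real_inner_comm y ν]
      split_ifs with hy
      · rw [max_eq_left (by linarith)]; ring
      · rw [max_eq_right (by linarith)]; ring
    simp only [h1, integral_neg, neg_lt_zero]
    obtain ⟨s, hs, hqs⟩ := hqν ν hν
    refine Continuous.integral_pos_of_hasCompactSupport_nonneg_nonzero (x := -(s • ν))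
      (by fun_prop) hqc.mul_right (fun y => mul_nonneg (hq0 y) (le_max_right _ _)) ?_
    refine (mul_pos hqs (lt_max_of_lt_left ?_)).ne'
    rw [inner_neg_left, neg_neg, real_inner_smul_left, real_inner_self_eq_norm_sq, hν]
    simpa using hs
  have key := h φ hφ hφc ν w
  rw [hint, hint, hcw, zero_smul, neg_inj] at key
  exact sub_eq_zero.1 ((smul_eq_zero.1 key).resolve_left hcν.ne)

/-- The blow-up at a point of a bounded field which is curl-free in the sense of distributions. -/
theorem curl_free_blow_up {Ω : Set E} {ξ : E} (hΩ : Ω ∈ 𝓝 ξ) {G L : E → E →L[ℝ] F}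
    (hG : StronglyMeasurable G) {C : ℝ} (hGC : ∀ x, ‖G x‖ ≤ C)
    (hcurl : ∀ φ : E → ℝ, ContDiff ℝ ∞ φ → HasCompactSupport φ → tsupport φ ⊆ Ω → ∀ v w : E,
      ∫ x in Ω, fderiv ℝ φ x v • G x w = ∫ x in Ω, fderiv ℝ φ x w • G x v)
    (hL : ∀ᵐ y, Tendsto (fun t : ℝ => G (ξ + t • y)) (𝓝[>] 0) (𝓝 (L y)))
    {φ : E → ℝ} (hφ : ContDiff ℝ ∞ φ) (hφc : HasCompactSupport φ) (v w : E) :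
    ∫ y, fderiv ℝ φ y v • L y w = ∫ y, fderiv ℝ φ y w • L y v := by
  have hφ' : ∀ v, Continuous fun y => fderiv ℝ φ y v := fun v =>
    (hφ.continuous_fderiv (by simp)).clm_apply continuous_const
  have hlim : ∀ v w : E, Tendsto (fun t : ℝ => ∫ y, fderiv ℝ φ y v • G (ξ + t • y) w) (𝓝[>] 0)
      (𝓝 (∫ y, fderiv ℝ φ y v • L y w)) := fun v w => by
    refine tendsto_integral_filter_of_dominated_convergence
      (fun y => ‖fderiv ℝ φ y v‖ * (C * ‖w‖)) ?_ ?_ ?_ ?_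
    · refine Eventually.of_forall fun t => ?_
      have h1 : StronglyMeasurable fun y => G (ξ + t • y) :=
        hG.comp_measurable (by fun_prop)
      exact ((hφ' v).stronglyMeasurable.smul
        ((ContinuousLinearMap.apply ℝ F w).continuous.comp_stronglyMeasurable h1)).aestronglyMeasurable
    · refine Eventually.of_forall fun t => Eventually.of_forall fun y => ?_
      rw [norm_smul]
      gcongr
      exact ((G _).le_opNorm w).trans (by gcongr; exact hGC _)
    · exact (((hφ' v).integrable_of_hasCompactSupport (hφc.fderiv_apply ℝ v)).norm).mul_const _
    · filter_upwards [hL] with y hy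
      exact (((ContinuousLinearMap.apply ℝ F w).continuous.tendsto _).comp hy).const_smul _
  refine tendsto_nhds_unique_of_eventuallyEq (hlim v w) (hlim w v) ?_
  obtain ⟨R, hR0, hR⟩ := hφc.isCompact.isBounded.exists_pos_norm_le
  obtain ⟨ρ, hρ, hball⟩ := Metric.mem_nhds_iff.1 hΩ
  have hsmall : ∀ᶠ t : ℝ in 𝓝[>] 0, t < ρ / R :=
    (eventually_lt_nhds (by positivity)).filter_mono nhdsWithin_le_nhds
  filter_upwards [hsmall, self_mem_nhdsWithin] with t htρ ht0
  have ht0 : 0 < t := ht0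
  -- The test function is concentrated at scale `t`, so that it is supported in `Ω` and the curl
  -- identity applies before the limit.
  let ψ : E → ℝ := fun x => φ (t⁻¹ • (x - ξ))
  have hψ : ContDiff ℝ ∞ ψ := hφ.comp (by fun_prop)
  have hψ' : ∀ x v, fderiv ℝ ψ x v = t⁻¹ * fderiv ℝ φ (t⁻¹ • (x - ξ)) v := fun x v => by
    have h1 : HasFDerivAt (fun x : E => t⁻¹ • (x - ξ)) (t⁻¹ • ContinuousLinearMap.id ℝ E) x :=
      ((hasFDerivAt_id x).sub_const ξ).const_smul t⁻¹
    have h2 := ((hφ.differentiable (by simp)) (t⁻¹ • (x - ξ))).hasFDerivAt.comp x h1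
    have h3 : fderiv ℝ ψ x = _ := h2.fderiv
    rw [h3]
    simp
  have hts : tsupport ψ ⊆ Metric.closedBall ξ (t * R) := by
    refine closure_minimal (fun x hx => ?_) Metric.isClosed_closedBall
    have h1 := hR _ (subset_tsupport φ (show t⁻¹ • (x - ξ) ∈ Function.support φ from hx))
    rw [norm_smul, norm_inv, Real.norm_of_nonneg ht0.le, inv_mul_le_iff₀ ht0] at h1
    rwa [Metric.mem_closedBall, dist_eq_norm]
  have hψc : HasCompactSupport ψ :=
    (isCompact_closedBall ξ (t * R)).of_isClosed_subset (isClosed_tsupport ψ) hts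
  have hψΩ : tsupport ψ ⊆ Ω := hts.trans ((Metric.closedBall_subset_ball
    (by rwa [lt_div_iff₀ hR0] at htρ)).trans hball)
  -- The scaling factors are the same for both sides of the curl identity and cancel.
  have hscale : ∀ v w : E, ∫ x in Ω, fderiv ℝ ψ x v • G x w =
      |t ^ Module.finrank ℝ E| • t⁻¹ • ∫ y, fderiv ℝ φ y v • G (ξ + t • y) w := fun v w => by
    rw [setIntegral_eq_integral_of_forall_compl_eq_zero, ← integral_add_left_eq_self _ ξ,
      ← integral_smul, ← Measure.integral_comp_inv_smul]
    · refine integral_congr_ae (Eventually.of_forall fun x => ?_)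
      simp only [hψ', add_sub_cancel_left, smul_inv_smul₀ ht0.ne', mul_smul]
    · intro x hx
      have : x ∉ tsupport (fderiv ℝ ψ · v) := fun h =>
        hx (hψΩ (tsupport_fderiv_apply_subset ℝ v h))
      rw [image_eq_zero_of_notMem_tsupport this, zero_smul]
  have key := hcurl ψ hψ hψc hψΩ v w
  rw [hscale, hscale] at key
  exact smul_right_injective F (inv_ne_zero ht0.ne')
    (smul_right_injective F (abs_pos.2 (pow_pos ht0 _).ne').ne' key)

end HalfSpace

end HadamardJump

namespace HadamardJump

variable {d : ℕ}

/-! ### The piecewise gradient and its curl. -/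

section UpToBoundary

variable {U : Set (Euc d)} {y : Euc d → Euc d}

theorem IsC1UpToBoundary.contDiffAt (hy : IsC1UpToBoundary U y) {x : Euc d} (hx : x ∈ closure U) :
    ContDiffAt ℝ 1 y x := by
  obtain ⟨V, hV, hUV, h⟩ := hy
  exact h.contDiffAt (hV.mem_nhds (hUV hx))

theorem IsC1UpToBoundary.differentiableAt (hy : IsC1UpToBoundary U y) {x : Euc d}
    (hx : x ∈ closure U) : DifferentiableAt ℝ y x :=
  (hy.contDiffAt hx).differentiableAt one_ne_zero

theorem IsC1UpToBoundary.continuousAt_fderiv (hy : IsC1UpToBoundary U y) {x : Euc d}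
    (hx : x ∈ closure U) : ContinuousAt (fderiv ℝ y) x :=
  (hy.contDiffAt hx).continuousAt_fderiv one_ne_zero

theorem IsC1UpToBoundary.exists_norm_fderiv_le (hy : IsC1UpToBoundary U y)
    (hU : Bornology.IsBounded U) : ∃ C, ∀ x ∈ closure U, ‖fderiv ℝ y x‖ ≤ C :=
  hU.isCompact_closure.exists_bound_of_continuousOn fun _ hx =>
    (hy.continuousAt_fderiv hx).continuousWithinAt

end UpToBoundary

/-- The field equal to `Dy⁺` on `Ω⁺`, to `Dy⁻` on `Ω⁻`, and to zero elsewhere. -/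
def piecewiseFDeriv (Ωp Ωm : Set (Euc d)) (yp ym : Euc d → Euc d) (x : Euc d) :
    Euc d →L[ℝ] Euc d :=
  Ωp.indicator (fderiv ℝ yp) x + Ωm.indicator (fderiv ℝ ym) x

section PiecewiseFDeriv

variable {Ωp Ωm : Set (Euc d)} {yp ym : Euc d → Euc d}

theorem piecewiseFDeriv_of_mem_left (h : Disjoint Ωp Ωm) {x : Euc d} (hx : x ∈ Ωp) :
    piecewiseFDeriv Ωp Ωm yp ym x = fderiv ℝ yp x := by
  rw [piecewiseFDeriv, indicator_of_mem hx, indicator_of_notMem (disjoint_left.1 h hx), add_zero]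

theorem piecewiseFDeriv_of_mem_right (h : Disjoint Ωp Ωm) {x : Euc d} (hx : x ∈ Ωm) :
    piecewiseFDeriv Ωp Ωm yp ym x = fderiv ℝ ym x := by
  rw [piecewiseFDeriv, indicator_of_mem hx, indicator_of_notMem (disjoint_right.1 h hx), zero_add]

theorem stronglyMeasurable_piecewiseFDeriv (hΩp : IsOpen Ωp) (hΩm : IsOpen Ωm) :
    StronglyMeasurable (piecewiseFDeriv Ωp Ωm yp ym) :=
  (((measurable_fderiv ℝ yp).indicator hΩp.measurableSet).add
    ((measurable_fderiv ℝ ym).indicator hΩm.measurableSet)).stronglyMeasurable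

theorem exists_norm_piecewiseFDeriv_le (hyp : IsC1UpToBoundary Ωp yp)
    (hym : IsC1UpToBoundary Ωm ym) (hp : Bornology.IsBounded Ωp) (hm : Bornology.IsBounded Ωm) :
    ∃ C, ∀ x, ‖piecewiseFDeriv Ωp Ωm yp ym x‖ ≤ C := by
  obtain ⟨C, hC⟩ := hyp.exists_norm_fderiv_le hp
  obtain ⟨D, hD⟩ := hym.exists_norm_fderiv_le hm
  refine ⟨max C 0 + max D 0, fun x => (norm_add_le _ _).trans (add_le_add ?_ ?_)⟩
  · by_cases hx : x ∈ Ωp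
    · rw [indicator_of_mem hx]; exact (hC x (subset_closure hx)).trans (le_max_left _ _)
    · rw [indicator_of_notMem hx, norm_zero]; exact le_max_right _ _
  · by_cases hx : x ∈ Ωm
    · rw [indicator_of_mem hx]; exact (hD x (subset_closure hx)).trans (le_max_left _ _)
    · rw [indicator_of_notMem hx, norm_zero]; exact le_max_right _ _

/-- As `Γ` is null, an arbitrary representative of the weak derivative may be replaced by this
explicit measurable field, whose pointwise limits at `Γ` can be computed. -/
theorem WeakDerivPiecewise.hasWeakDeriv {Ω Γ : Set (Euc d)} {z : Euc d → Euc d}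
    (hz : WeakDerivPiecewise Ω Ωp Ωm yp ym z) (hdisj : Disjoint Ωp Ωm)
    (hΩp : IsOpen Ωp) (hΩm : IsOpen Ωm)
    (hunion : Ω = Ωp ∪ Γ ∪ Ωm) (hΓ : volume Γ = 0) :
    HasWeakDeriv Ω z (piecewiseFDeriv Ωp Ωm yp ym) := by
  obtain ⟨Dz, hDz, hp, hm⟩ := hz
  have hae : Dz =ᵐ[volume.restrict Ω] piecewiseFDeriv Ωp Ωm yp ym := by
    rw [hunion, EventuallyEq, ae_restrict_union_eq, ae_restrict_union_eq, eventually_sup,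
      eventually_sup, Measure.restrict_eq_zero.2 hΓ, ae_zero]
    refine ⟨⟨?_, eventually_bot⟩, ?_⟩
    · filter_upwards [hp, ae_restrict_mem hΩp.measurableSet] with x hx hxp
      rw [hx, piecewiseFDeriv_of_mem_left hdisj hxp]
    · filter_upwards [hm, ae_restrict_mem hΩm.measurableSet] with x hx hxm
      rw [hx, piecewiseFDeriv_of_mem_right hdisj hxm]
  refine ⟨hDz.locallyIntegrable, fun x hx => ?_, fun φ h1 h2 h3 v => ?_⟩
  · obtain ⟨s, hs, hi⟩ := hDz.locallyIntegrable_deriv x hx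
    refine ⟨s ∩ Ω, inter_mem hs self_mem_nhdsWithin, ?_⟩
    exact (hi.mono_set inter_subset_left).congr_fun_ae
      (ae_mono (Measure.restrict_mono inter_subset_right le_rfl) hae)
  · rw [hDz.integral_eq φ h1 h2 h3 v]
    congr 1
    refine integral_congr_ae ?_
    filter_upwards [hae] with x hx
    rw [hx]

end PiecewiseFDeriv

section Curl

/-- The weak derivative in direction `w` is tested with `∂_v φ`; symmetry of the Hessian of `φ`
allows `v` and `w` to be exchanged. -/
theorem HasWeakDeriv.integral_fderiv_smul_comm {Ω : Set (Euc d)} {z : Euc d → Euc d}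
    {G : Euc d → Euc d →L[ℝ] Euc d} (hz : HasWeakDeriv Ω z G) {φ : Euc d → ℝ}
    (hφ : ContDiff ℝ ∞ φ) (hφc : HasCompactSupport φ) (hφΩ : tsupport φ ⊆ Ω) (v w : Euc d) :
    ∫ x in Ω, fderiv ℝ φ x v • G x w = ∫ x in Ω, fderiv ℝ φ x w • G x v := by
  have hdiff : ContDiff ℝ ∞ (fderiv ℝ φ) := hφ.fderiv_right (by simp)
  have key : ∀ v w : Euc d, ∫ x in Ω, (fderiv ℝ (fderiv ℝ φ) x w v) • z x =
      -∫ x in Ω, fderiv ℝ φ x v • G x w := fun v w => by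
    rw [← hz.integral_eq (fun x => fderiv ℝ φ x v) (hdiff.clm_apply contDiff_const)
      (hφc.fderiv_apply ℝ v) ((tsupport_fderiv_apply_subset ℝ v).trans hφΩ) w]
    refine integral_congr_ae (Eventually.of_forall fun x => ?_)
    simp only
    rw [fderiv_clm_apply ((hdiff.differentiable (by simp)) x) (differentiableAt_const v)]
    simp
  have hsymm : ∀ x, fderiv ℝ (fderiv ℝ φ) x w v = fderiv ℝ (fderiv ℝ φ) x v w := fun x =>
    second_derivative_symmetric (fun y => (hφ.differentiable (by simp) y).hasFDerivAt)
      (hdiff.differentiable (by simp) x).hasFDerivAt w v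
  have h1 := key v w
  simp only [hsymm] at h1
  rw [key w v] at h1
  exact (neg_inj.1 h1).symm

end Curl

/-! ### The two sides of the surface. -/

section Sides

variable {E : Type*} [NormedAddCommGroup E] [InnerProductSpace ℝ E]

/-- Near a point `ξ` at which `Γ` is flat in the direction `ν`, small homothetic copies of a
segment contained in an open half-space do not meet `Γ`. -/
theorem eventually_segment_disjoint {Γ : Set E} {Ω : Set E} {ξ ν a b : E} (hΩ : Ω ∈ 𝓝 ξ)
    (hflat : ∀ ε > (0 : ℝ), ∀ᶠ p in 𝓝 ξ, p ∈ Γ → |inner ℝ ν (p - ξ)| ≤ ε * ‖p - ξ‖)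
    (ha : 0 < inner ℝ ν a) (hb : 0 < inner ℝ ν b) :
    ∀ᶠ t : ℝ in 𝓝[>] 0, ∀ w ∈ segment ℝ a b, ξ + t • w ∈ Ω \ Γ := by
  let m := min (inner ℝ ν a) (inner ℝ ν b)
  let R := max ‖a‖ ‖b‖ + 1
  have hm : 0 < m := lt_min ha hb
  have hR : 0 < R := by positivity
  have hmem : ∀ w ∈ segment ℝ a b, m ≤ inner ℝ ν w ∧ ‖w‖ < R := by
    intro w hw
    constructor
    · have hconv : Convex ℝ {w : E | m ≤ inner ℝ ν w} :=
        convex_halfSpace_ge (innerSL ℝ ν).toLinearMap.isLinear m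
      exact hconv.segment_subset (show m ≤ inner ℝ ν a from min_le_left _ _)
        (show m ≤ inner ℝ ν b from min_le_right _ _) hw
    · have h1 := (convex_ball (0 : E) R).segment_subset
        (mem_ball_zero_iff.2 (lt_of_le_of_lt (le_max_left _ _) (lt_add_one _)))
        (mem_ball_zero_iff.2 (lt_of_le_of_lt (le_max_right _ _) (lt_add_one _))) hw
      simpa using h1
  -- On the segment the normal component is at least `m` and the norm below `R`. Flatness with `ε =
  -- m / (2R)` would bound the normal component of a point of `Γ` by `t m / 2`, while it is at least
  -- `t m`.
  obtain ⟨δ, hδ, hball⟩ := Metric.mem_nhds_iff.1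
    (inter_mem hΩ (hflat (m / R / 2) (by positivity)))
  have hsmall : ∀ᶠ t : ℝ in 𝓝[>] 0, t < δ / R :=
    (eventually_lt_nhds (by positivity)).filter_mono nhdsWithin_le_nhds
  filter_upwards [hsmall, self_mem_nhdsWithin] with t htδ ht0 w hw
  have ht0 : 0 < t := ht0
  obtain ⟨h1, h2⟩ := hmem w hw
  rw [lt_div_iff₀ hR] at htδ
  have hp : ξ + t • w ∈ Metric.ball ξ δ := by
    rw [Metric.mem_ball, dist_eq_norm, add_sub_cancel_left, norm_smul, Real.norm_of_nonneg ht0.le]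
    nlinarith
  obtain ⟨h3, h4⟩ := hball hp
  refine ⟨h3, fun hΓ => ?_⟩
  have h5 := h4 hΓ
  rw [add_sub_cancel_left, norm_smul, Real.norm_of_nonneg ht0.le, real_inner_smul_right] at h5
  have h6 := (le_abs_self _).trans h5
  have h7 : m / R / 2 * (t * ‖w‖) ≤ m / R / 2 * (t * R) := by gcongr
  have h8 : m / R / 2 * (t * R) = t * m / 2 := by field_simp
  have h9 : t * m ≤ t * inner ℝ ν w := by gcongr
  have : 0 < t * m := by positivity
  linarith

variable {Ω Ωp Ωm Γ : Set (Euc d)}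

/-- The small segment from `ξ - tν` to `ξ + tw` is connected and misses `Γ`, so it stays on the side
of `ξ - tν`, which the outward normal identifies. -/
theorem eventually_mem_left_of_inner_neg {ξ ν w : Euc d} (hΩ : Ω ∈ 𝓝 ξ)
    (hΩp : IsOpen Ωp) (hΩm : IsOpen Ωm) (hdisj : Disjoint Ωp Ωm)
    (hunion : Ω = Ωp ∪ Γ ∪ Ωm) (hΓ : IsC1Surface Γ) (hξ : ξ ∈ Γ)
    (hν : IsOutwardUnitNormal Ωp Γ ξ ν) (hw : inner ℝ ν w < 0) :
    ∀ᶠ t : ℝ in 𝓝[>] 0, ξ + t • w ∈ Ωp := by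
  have hself : inner ℝ ν ν = (1 : ℝ) := by
    rw [real_inner_self_eq_norm_sq, hν.norm_eq_one, one_pow]
  have hseg := eventually_segment_disjoint (ν := -ν) (a := -ν) (b := w) (Γ := Γ) hΩ
    (fun ε hε => by
      simpa only [inner_neg_left, abs_neg] using
        hΓ.eventually_inner_normal_le hξ hν.orthogonal hε)
    (by rw [inner_neg_neg, hself]; exact one_pos) (by simpa using hw)
  filter_upwards [hseg, hν.outward] with t ht ho
  have hconn : IsPreconnected ((fun w => ξ + t • w) '' segment ℝ (-ν) w) :=
    (convex_segment (-ν) w).isPreconnected.image _ (by fun_prop)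
  refine hconn.subset_left_of_subset_union hΩp hΩm hdisj ?_ ?_
    ⟨w, right_mem_segment ℝ _ _, rfl⟩
  · rintro _ ⟨u, hu, rfl⟩
    obtain ⟨h1, h2⟩ := ht u hu
    rw [hunion] at h1
    rcases h1 with (h1 | h1) | h1
    exacts [Or.inl h1, (h2 h1).elim, Or.inr h1]
  · refine ⟨_, ⟨-ν, left_mem_segment ℝ _ _, rfl⟩, ?_⟩
    simpa [sub_eq_add_neg] using ho.1

theorem eventually_mem_right_of_inner_pos {ξ ν w : Euc d} (hΩ : Ω ∈ 𝓝 ξ)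
    (hΩp : IsOpen Ωp) (hΩm : IsOpen Ωm) (hdisj : Disjoint Ωp Ωm)
    (hunion : Ω = Ωp ∪ Γ ∪ Ωm) (hΓ : IsC1Surface Γ) (hξ : ξ ∈ Γ)
    (hν : IsOutwardUnitNormal Ωp Γ ξ ν) (hw : 0 < inner ℝ ν w) :
    ∀ᶠ t : ℝ in 𝓝[>] 0, ξ + t • w ∈ Ωm := by
  have hself : inner ℝ ν ν = (1 : ℝ) := by
    rw [real_inner_self_eq_norm_sq, hν.norm_eq_one, one_pow]
  have hseg := eventually_segment_disjoint (a := ν) (b := w) (Γ := Γ) hΩ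
    (fun ε hε => hΓ.eventually_inner_normal_le hξ hν.orthogonal hε) 
    (by rw [hself]; exact one_pos) hw
  filter_upwards [hseg, hν.outward] with t ht ho
  have hconn : IsPreconnected ((fun w => ξ + t • w) '' segment ℝ ν w) :=
    (convex_segment ν w).isPreconnected.image _ (by fun_prop)
  have hsub : (fun w => ξ + t • w) '' segment ℝ ν w ⊆ Ωm ∪ Ωp := by
    rintro _ ⟨u, hu, rfl⟩
    obtain ⟨h1, h2⟩ := ht u hu
    rw [hunion] at h1
    rcases h1 with (h1 | h1) | h1
    exacts [Or.inr h1, (h2 h1).elim, Or.inl h1]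
  -- `outward` only says that `ξ + tν` is outside `Ω⁺`; as the segment misses `Γ`, it must be in
  -- `Ω⁻`.
  have hν' : ξ + t • ν ∈ (fun w => ξ + t • w) '' segment ℝ ν w :=
    ⟨ν, left_mem_segment ℝ _ _, rfl⟩
  exact hconn.subset_left_of_subset_union hΩm hΩp hdisj.symm hsub
    ⟨_, hν', (hsub hν').resolve_right ho.2⟩ ⟨w, right_mem_segment ℝ _ _, rfl⟩

end Sides

/-! ### Necessity of the jump condition. -/

section Necessity

variable {Ω Ωp Ωm Γ : Set (Euc d)} {yp ym n z : Euc d → Euc d}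

theorem fderiv_apply_eq_of_weakDerivPiecewise {ξ ν : Euc d} (hd : d ≠ 0) (hΩ : IsOpen Ω)
    (hΩb : Bornology.IsBounded Ω)
    (hΩp : IsOpen Ωp) (hΩm : IsOpen Ωm) (hdisj : Disjoint Ωp Ωm)
    (hunion : Ω = Ωp ∪ Γ ∪ Ωm) (hΓp : Γ ⊆ closure Ωp) (hΓm : Γ ⊆ closure Ωm)
    (hΓ : IsC1Surface Γ) (hyp : IsC1UpToBoundary Ωp yp) (hym : IsC1UpToBoundary Ωm ym)
    (hξ : ξ ∈ Γ) (hν : IsOutwardUnitNormal Ωp Γ ξ ν)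
    (hz : WeakDerivPiecewise Ω Ωp Ωm yp ym z) {w : Euc d} (hw : inner ℝ ν w = 0) :
    fderiv ℝ yp ξ w = fderiv ℝ ym ξ w := by
  have hpΩ : Ωp ⊆ Ω := hunion ▸ subset_union_left.trans subset_union_left
  have hmΩ : Ωm ⊆ Ω := hunion ▸ subset_union_right
  have hΓΩ : Γ ⊆ Ω := hunion ▸ subset_union_right.trans subset_union_left
  have hΩξ : Ω ∈ 𝓝 ξ := hΩ.mem_nhds (hΓΩ hξ)
  have hweak := hz.hasWeakDeriv hdisj hΩp hΩm hunion (hΓ.volume_eq_zero hd)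
  obtain ⟨C, hC⟩ := exists_norm_piecewiseFDeriv_le hyp hym (hΩb.subset hpΩ) (hΩb.subset hmΩ)
  refine apply_eq_of_curl_free_half_space hν.norm_eq_one (fun φ hφ hφc v w => ?_) hw
  refine curl_free_blow_up hΩξ
    (L := fun y => if inner ℝ ν y < 0 then fderiv ℝ yp ξ else fderiv ℝ ym ξ)
    (stronglyMeasurable_piecewiseFDeriv hΩp hΩm) hC
    (fun φ h1 h2 h3 v w => hweak.integral_fderiv_smul_comm h1 h2 h3 v w) ?_ hφ hφc v w
  -- The blow-up limit is identified only off the tangent hyperplane, which is null.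
  have hnull : ∀ᵐ y : Euc d, inner ℝ ν y ≠ 0 := by
    have h1 : (Submodule.span ℝ {ν})ᗮ ≠ ⊤ := fun h => by
      have h2 : ν ∈ (Submodule.span ℝ {ν})ᗮ := h ▸ Submodule.mem_top
      rw [Submodule.mem_orthogonal_singleton_iff_inner_right, real_inner_self_eq_norm_sq,
        hν.norm_eq_one] at h2
      norm_num at h2
    have h2 := Measure.addHaar_submodule (volume : Measure (Euc d)) _ h1
    filter_upwards [measure_eq_zero_iff_ae_notMem.1 h2] with y hy h
    exact hy (Submodule.mem_orthogonal_singleton_iff_inner_right.2 h)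
  filter_upwards [hnull] with y hy
  have htend : Tendsto (fun t : ℝ => ξ + t • y) (𝓝[>] 0) (𝓝 ξ) := by
    have : Continuous fun t : ℝ => ξ + t • y := by fun_prop
    have h1 := this.tendsto 0
    rw [zero_smul, add_zero] at h1
    exact h1.mono_left nhdsWithin_le_nhds
  rcases hy.lt_or_gt with hy | hy
  · rw [if_pos hy]
    refine ((hyp.continuousAt_fderiv (hΓp hξ)).tendsto.comp htend).congr' ?_
    filter_upwards [eventually_mem_left_of_inner_neg hΩξ hΩp hΩm hdisj hunion hΓ hξ hν hy]
      with t ht using (piecewiseFDeriv_of_mem_left hdisj ht).symm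
  · rw [if_neg hy.not_gt]
    refine ((hym.continuousAt_fderiv (hΓm hξ)).tendsto.comp htend).congr' ?_
    filter_upwards [eventually_mem_right_of_inner_pos hΩξ hΩp hΩm hdisj hunion hΓ hξ hν hy]
      with t ht using (piecewiseFDeriv_of_mem_right hdisj ht).symm

theorem jumpCondition_of_tangential_eq
    (hΓp : Γ ⊆ closure Ωp) (hΓm : Γ ⊆ closure Ωm)
    (hyp : IsC1UpToBoundary Ωp yp) (hym : IsC1UpToBoundary Ωm ym) (hnc : ContinuousOn n Γ)
    (hn : ∀ x ∈ Γ, ‖n x‖ = 1)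
    (h : ∀ x ∈ Γ, ∀ w, inner ℝ (n x) w = 0 → fderiv ℝ yp x w = fderiv ℝ ym x w) :
    JumpCondition Γ yp ym n := by
  refine ⟨fun x => (fderiv ℝ yp x - fderiv ℝ ym x) (n x), ?_, fun x hx => ?_⟩
  · refine ContinuousOn.clm_apply (fun x hx => ?_) hnc
    exact ((hyp.continuousAt_fderiv (hΓp hx)).sub
      (hym.continuousAt_fderiv (hΓm hx))).continuousWithinAt
  · refine ContinuousLinearMap.ext fun w => ?_
    -- Agreement is used on the tangential part of `w`; the normal part gives the rank-one term.
    have h1 := h x hx (w - inner ℝ (n x) w • n x) (by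
      rw [inner_sub_right, real_inner_smul_right, real_inner_self_eq_norm_sq, hn x hx]
      ring)
    rw [map_sub, map_sub, map_smul, map_smul] at h1
    have h2 := sub_eq_sub_iff_add_eq_add.1 h1
    rw [add_apply, InnerProductSpace.rankOne_apply]
    change _ = fderiv ℝ ym x w + inner ℝ (n x) w • (fderiv ℝ yp x (n x) - fderiv ℝ ym x (n x))
    rw [smul_sub, ← add_sub_assoc, ← h2, add_sub_cancel_right]

end Necessity

end HadamardJump

namespace HadamardJump

variable {d : ℕ}

/-! ### Boundedness and weak differentiability. -/

section Bounded

variable {F : Type*} [NormedAddCommGroup F]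

/-- Near a boundary point, a vertical shift by a fixed `h` stays above the graph and ends in a
compact ball inside `Ω`, where `z` is bounded; along the shift `z` changes by at most `C h`.
Compactness of the closure finishes. -/
theorem IsC1Domain.exists_bound_of_eventually_norm_sub_le {Ω : Set (Euc d)} (hΩ : IsC1Domain Ω)
    (hΩb : Bornology.IsBounded Ω) {z : Euc d → F} {C : ℝ}
    (hz : ∀ x ∈ Ω, ∀ᶠ y in 𝓝 x, ‖z y - z x‖ ≤ C * ‖y - x‖) :
    ∃ M, ∀ x ∈ Ω, ‖z x‖ ≤ M := by
  have hcont : ContinuousOn z Ω := fun x hx =>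
    (continuousAt_of_eventually_norm_sub_le (hz x hx)).continuousWithinAt
  suffices h : ∃ M, ∀ x ∈ closure Ω ∩ Ω, ‖z x‖ ≤ M by
    rwa [inter_eq_right.2 subset_closure] at h
  refine hΩb.isCompact_closure.induction_on (p := fun s => ∃ M, ∀ x ∈ s ∩ Ω, ‖z x‖ ≤ M)
    ⟨0, by simp⟩ ?_ ?_ fun ξ hξ => ?_
  · rintro s t hst ⟨M, hM⟩
    exact ⟨M, fun x hx => hM x ⟨hst hx.1, hx.2⟩⟩
  · rintro s t ⟨M, hM⟩ ⟨N, hN⟩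
    refine ⟨max M N, ?_⟩
    rintro x ⟨hx | hx, hxΩ⟩
    exacts [(hM x ⟨hx, hxΩ⟩).trans (le_max_left _ _), (hN x ⟨hx, hxΩ⟩).trans (le_max_right _ _)]
  by_cases hξΩ : ξ ∈ Ω
  · refine ⟨{x | ‖z x‖ < ‖z ξ‖ + 1}, mem_nhdsWithin_of_mem_nhds ?_, ‖z ξ‖ + 1,
      fun x hx => le_of_lt hx.1⟩
    exact (continuousAt_of_eventually_norm_sub_le (hz ξ hξΩ)).norm.eventually
      (eventually_lt_nhds (lt_add_one _))
  have hξf : ξ ∈ frontier Ω := by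
    rw [hΩ.isOpen.frontier_eq]; exact ⟨hξ, hξΩ⟩
  obtain ⟨r, hr, T, g, hg, hgΩ, hgf⟩ := hΩ.boundary ξ hξf
  have hmemΩ : ∀ x ∈ Metric.ball ξ r, x ∈ Ω ↔ g (T x).fst < (T x).snd := fun x hx => by
    have := Set.ext_iff.1 hgΩ x
    simpa only [mem_inter_iff, hx, and_true, mem_ofPred_eq, true_and] using this
  have hξg : (T ξ).snd = g (T ξ).fst := by
    have := (Set.ext_iff.1 hgf ξ).1 ⟨hξf, Metric.mem_ball_self hr⟩
    exact this.2
  let e : Euc d := T.linearIsometryEquiv.symm (WithLp.toLp 2 (0, 1))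
  have he : ‖e‖ = 1 := by
    rw [LinearIsometryEquiv.norm_map, WithLp.prod_norm_eq_of_L2]
    simp
  have hTe : ∀ x (t : ℝ), T (x + t • e) = T x + WithLp.toLp 2 (0, t) := fun x t => by
    have h1 := T.map_vadd x (t • e)
    rw [vadd_eq_add, vadd_eq_add, add_comm] at h1
    rw [h1, map_smul, LinearIsometryEquiv.apply_symm_apply, add_comm]
    congr 1
    rw [← WithLp.toLp_smul]
    simp
  have hT1 : ∀ x (t : ℝ), (T (x + t • e)).fst = (T x).fst := fun x t => by simp [hTe]
  have hT2 : ∀ x (t : ℝ), (T (x + t • e)).snd = (T x).snd + t := fun x t => by simp [hTe]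
  let k : Euc d → ℝ := fun x => (T x).snd - g (T x).fst
  have hk : Continuous k := by
    have := hg.continuous
    have := T.continuous
    fun_prop
  have hkξ : k ξ = 0 := sub_eq_zero.2 hξg
  -- With `η ≤ h = r / 4` all points used stay within `r / 2` of `ξ`, hence in the graph
  -- neighbourhood.
  let h : ℝ := r / 4
  have hh : 0 < h := by positivity
  obtain ⟨δ, hδ, hball⟩ := Metric.mem_nhds_iff.1
    (hk.continuousAt.eventually (lt_mem_nhds (show -h < k ξ by rw [hkξ]; linarith)))
  let η : ℝ := min (δ / 2) h
  have hη : 0 < η := lt_min (by positivity) hh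
  let K : Set (Euc d) := Metric.closedBall (ξ + h • e) η
  have hKΩ : K ⊆ Ω := fun p hp => by
    have hp' : dist p (ξ + h • e) ≤ η := hp
    have h1 : p - h • e ∈ Metric.ball ξ δ := by
      rw [Metric.mem_ball, dist_eq_norm, sub_sub, add_comm, ← dist_eq_norm]
      have := min_le_left (δ / 2) h
      exact lt_of_le_of_lt hp' (by linarith)
    have h2 : -h < k (p - h • e) := hball h1
    have h3 : k p = k (p - h • e) + h := by
      have h4 := hT1 (p - h • e) h
      have h5 := hT2 (p - h • e) h
      rw [sub_add_cancel] at h4 h5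
      simp only [k, h4, h5]
      ring
    refine (hmemΩ p ?_).2 (sub_pos.1 (show 0 < k p by linarith))
    rw [Metric.mem_ball]
    have h6 : dist (ξ + h • e) ξ = h := by
      rw [dist_eq_norm, add_sub_cancel_left, norm_smul, he, mul_one, Real.norm_of_nonneg hh.le]
    have h7 := dist_triangle p (ξ + h • e) ξ
    have h8 : η ≤ h := min_le_right _ _
    have h9 : h = r / 4 := rfl
    linarith
  obtain ⟨M, hM⟩ := (isCompact_closedBall (ξ + h • e) η).exists_bound_of_continuousOn
    (hcont.mono hKΩ)
  refine ⟨Metric.ball ξ η, mem_nhdsWithin_of_mem_nhds (Metric.ball_mem_nhds _ hη), M + C * h, ?_⟩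
  rintro x ⟨hx, hxΩ⟩
  have hη' : η ≤ h := min_le_right _ _
  have hhr : h = r / 4 := rfl
  have hx' : dist x ξ < η := hx
  have hseg : segment ℝ x (x + h • e) ⊆ Ω := by
    rw [segment_eq_image']
    rintro _ ⟨t, ht, rfl⟩
    simp only [add_sub_cancel_left, smul_smul]
    have hxg : g (T x).fst < (T x).snd := (hmemΩ x (by rw [Metric.mem_ball]; linarith)).1 hxΩ
    have hth : 0 ≤ t * h := mul_nonneg ht.1 hh.le
    refine (hmemΩ _ ?_).2 (by rw [hT1, hT2]; linarith)
    rw [Metric.mem_ball]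
    have h7 := dist_triangle (x + (t * h) • e) x ξ
    have h6 : dist (x + (t * h) • e) x = t * h := by
      rw [dist_eq_norm, add_sub_cancel_left, norm_smul, he, mul_one, Real.norm_of_nonneg hth]
    have h8 : t * h ≤ 1 * h := mul_le_mul_of_nonneg_right ht.2 hh.le
    linarith
  have h1 := norm_sub_le_of_eventually_on_segment fun y hy => hz y (hseg hy)
  rw [add_sub_cancel_left, norm_smul, he, mul_one, Real.norm_of_nonneg hh.le] at h1
  have h2 : ‖z (x + h • e)‖ ≤ M := hM _ (by
    rw [Metric.mem_closedBall, dist_add_right]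
    exact hx'.le)
  have h3 := norm_sub_norm_le (z x) (z (x + h • e))
  rw [norm_sub_rev] at h3
  linarith

end Bounded

section WeakDerivative

theorem integral_lineDeriv_eq_zero_of_hasCompactSupport {E : Type*} [NormedAddCommGroup E]
    [NormedSpace ℝ E] [MeasurableSpace E] [BorelSpace E] [FiniteDimensional ℝ E]
    (μ : Measure E) [μ.IsAddHaarMeasure] {f : E → ℝ} {C : NNReal} (hf : LipschitzWith C f)
    (hfc : HasCompactSupport f) (v : E) : ∫ x, lineDeriv ℝ f x v ∂μ = 0 := by
  have h := (LipschitzWith.const (1 : ℝ)).integral_lineDeriv_mul_eq (μ := μ) hf hfc (-v)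
  simpa [lineDeriv] using h.symm

/-- A function which is uniformly Lipschitz at every point of an open set and differentiable almost
everywhere has its classical derivative as weak derivative. -/
theorem hasWeakDeriv_of_eventually_norm_sub_le {Ω : Set (Euc d)} (hΩ : IsOpen Ω)
    (hΩb : Bornology.IsBounded Ω) {z : Euc d → Euc d} {C : ℝ} (hC : 0 ≤ C)
    (hz : ∀ x ∈ Ω, ∀ᶠ y in 𝓝 x, ‖z y - z x‖ ≤ C * ‖y - x‖)
    {G : Euc d → Euc d →L[ℝ] Euc d} (hG : StronglyMeasurable G) {D : ℝ} (hGD : ∀ x, ‖G x‖ ≤ D)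
    (hzG : ∀ᵐ x ∂(volume.restrict Ω), HasFDerivAt z (G x) x) :
    HasWeakDeriv Ω z G := by
  have hcont : ContinuousOn z Ω := fun x hx =>
    (continuousAt_of_eventually_norm_sub_le (hz x hx)).continuousWithinAt
  have hzm : AEStronglyMeasurable z (volume.restrict Ω) :=
    hcont.aestronglyMeasurable hΩ.measurableSet
  have : IsFiniteMeasure (volume.restrict Ω) :=
    isFiniteMeasure_restrict.2 hΩb.measure_lt_top.ne
  refine ⟨hcont.locallyIntegrableOn hΩ.measurableSet,
    IntegrableOn.locallyIntegrableOn (Integrable.of_bound hG.aestronglyMeasurable D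
      (Eventually.of_forall hGD)), fun φ hφ hφc hφΩ v => ?_⟩
  obtain ⟨M, hM⟩ := hφc.isCompact.exists_bound_of_continuousOn (hcont.mono hφΩ)
  obtain ⟨B, hB⟩ := hφc.exists_bound_of_continuous hφ.continuous
  obtain ⟨L, hL⟩ := hφ.lipschitzWith_of_hasCompactSupport hφc (by simp)
  have hφd : Differentiable ℝ φ := hφ.differentiable (by simp)
  have hB0 : 0 ≤ B := (norm_nonneg _).trans (hB 0)
  have hφ0 : ∀ x ∉ tsupport φ, φ =ᶠ[𝓝 x] 0 := fun x hx => notMem_tsupport_iff_eventuallyEq.1 hx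
  have hφ'0 : ∀ x ∉ tsupport φ, fderiv ℝ φ x = 0 := fun x hx => by
    rw [(hφ0 x hx).fderiv_eq]; simp
  let h : Euc d → Euc d := fun x => φ x • z x
  have hh0 : ∀ x ∉ tsupport φ, h =ᶠ[𝓝 x] 0 := fun x hx => by
    filter_upwards [hφ0 x hx] with y hy
    simp [h, hy]
  -- Although `z` need not be Lipschitz on `Ω`, the cut-off product `φ z` is Lipschitz on the whole
  -- space.
  have hhL : LipschitzWith (B * C + L * max M 0).toNNReal h := by
    refine lipschitzWith_of_eventually_norm_sub_le fun x => ?_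
    rw [Real.coe_toNNReal _ (by positivity)]
    by_cases hx : x ∈ tsupport φ
    · filter_upwards [hz x (hφΩ hx)] with y hy
      have h1 : h y - h x = φ y • (z y - z x) + (φ y - φ x) • z x := by
        simp only [h]; module
      have h2 : ‖φ y - φ x‖ ≤ L * ‖y - x‖ := by
        simpa [dist_eq_norm] using hL.dist_le_mul y x
      have h3 : ‖z x‖ ≤ max M 0 := (hM x hx).trans (le_max_left _ _)
      rw [h1]
      calc _ ≤ ‖φ y‖ * ‖z y - z x‖ + ‖φ y - φ x‖ * ‖z x‖ := by
            refine (norm_add_le _ _).trans ?_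
            rw [norm_smul, norm_smul]
        _ ≤ B * (C * ‖y - x‖) + (L * ‖y - x‖) * max M 0 := by
            gcongr
            exact hB y
        _ = _ := by ring
    · have hx0 := hh0 x hx
      filter_upwards [hx0] with y hy
      rw [hy, hx0.self_of_nhds]
      simp only [Pi.zero_apply, sub_zero, norm_zero]
      positivity
  have hint1 : Integrable (fun x => fderiv ℝ φ x v • z x) (volume.restrict Ω) := by
    refine Integrable.of_bound ((((hφ.continuous_fderiv (by simp)).clm_apply
      continuous_const).aestronglyMeasurable).smul hzm) (L * ‖v‖ * max M 0)
      (Eventually.of_forall fun x => ?_)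
    by_cases hx : x ∈ tsupport φ
    · rw [norm_smul]
      gcongr
      · exact ((fderiv ℝ φ x).le_opNorm v).trans (by gcongr; exact norm_fderiv_le_of_lipschitz ℝ hL)
      · exact (hM x hx).trans (le_max_left _ _)
    · rw [hφ'0 x hx]
      simp only [zero_apply, zero_smul, norm_zero]
      positivity
  have hint2 : Integrable (fun x => φ x • G x v) (volume.restrict Ω) := by
    refine Integrable.of_bound (hφ.continuous.aestronglyMeasurable.smul
      ((ContinuousLinearMap.apply ℝ (Euc d) v).continuous.comp_stronglyMeasurable
        hG).aestronglyMeasurable) (B * (D * ‖v‖)) (Eventually.of_forall fun x => ?_)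
    rw [norm_smul]
    gcongr
    · exact hB x
    · exact ((G x).le_opNorm v).trans (by gcongr; exact hGD x)
  rw [eq_neg_iff_add_eq_zero, ← integral_add hint1 hint2]
  -- The claim is now that the derivative of `φ z` integrates to zero; it is checked on each scalar
  -- component.
  refine ext_inner_left ℝ fun e => ?_
  have hinner := integral_inner (𝕜 := ℝ) (hint1.add hint2) e
  simp only [Pi.add_apply] at hinner
  rw [← hinner, inner_zero_right]
  let he : Euc d → ℝ := fun x => inner ℝ e (h x)
  have heL : LipschitzWith (‖innerSL ℝ e‖₊ * (B * C + L * max M 0).toNNReal) he :=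
    (innerSL ℝ e).lipschitz.comp hhL
  have hec : HasCompactSupport he :=
    HasCompactSupport.intro hφc.isCompact fun x hx => by
      simp [he, h, image_eq_zero_of_notMem_tsupport hx]
  rw [← integral_lineDeriv_eq_zero_of_hasCompactSupport volume heL hec v,
    ← setIntegral_eq_integral_of_forall_compl_eq_zero (s := Ω)
      (f := fun x => lineDeriv ℝ he x v)]
  · refine integral_congr_ae ?_
    filter_upwards [hzG] with x hx
    have h1 : HasFDerivAt h (φ x • G x + (fderiv ℝ φ x).smulRight (z x)) x :=
      (hφd x).hasFDerivAt.smul hx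
    have h2 : HasLineDerivAt ℝ he _ x v :=
      ((innerSL ℝ e).hasFDerivAt.comp x h1 : HasFDerivAt he _ x).hasLineDerivAt v
    rw [h2.lineDeriv]
    simp [add_comm, inner_add_right, real_inner_smul_right]
  · intro x hx
    have h1 : he =ᶠ[𝓝 x] fun _ => 0 := by
      filter_upwards [hh0 x fun h => hx (hφΩ h)] with y hy
      simp [he, hy]
    have h2 : HasFDerivAt he (0 : Euc d →L[ℝ] ℝ) x :=
      (hasFDerivAt_const (0 : ℝ) x).congr_of_eventuallyEq h1
    rw [(h2.hasLineDerivAt v).lineDeriv, zero_apply]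

end WeakDerivative

end HadamardJump

namespace HadamardJump

/-! ### Construction of a piecewise primitive. -/

section LocalPrimitive

variable {X F : Type*} [TopologicalSpace X] [AddCommGroup F]

/-- Near `x`, the map `z` equals `f` on `A` and `g` on `B` up to additive constants. -/
def IsPiecewisePrimitiveAt (A B : Set X) (f g z : X → F) (x : X) : Prop :=
  ∃ c c' : F, ∀ᶠ y in 𝓝 x, (y ∈ A → z y = f y + c) ∧ (y ∈ B → z y = g y + c')

variable {A B : Set X} {f g z z' : X → F} {x : X}

theorem IsPiecewisePrimitiveAt.eventually (h : IsPiecewisePrimitiveAt A B f g z x) :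
    ∀ᶠ y in 𝓝 x, IsPiecewisePrimitiveAt A B f g z y := by
  obtain ⟨c, c', h⟩ := h
  filter_upwards [h.eventually_nhds] with y hy
  exact ⟨c, c', hy⟩

/-- In the application `A` and `B` both contain `Γ`. Each nearby `y` shares a piece with `x`, so the
constant of that piece cancels in the increment. -/
theorem IsPiecewisePrimitiveAt.eventually_sub_eq (h : IsPiecewisePrimitiveAt A B f g z x)
    (hx : ∀ᶠ y in 𝓝 x, (x ∈ A ∧ y ∈ A) ∨ (x ∈ B ∧ y ∈ B)) :
    ∀ᶠ y in 𝓝 x, (x ∈ A ∧ z y - z x = f y - f x) ∨ (x ∈ B ∧ z y - z x = g y - g x) := by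
  obtain ⟨c, c', h⟩ := h
  filter_upwards [h, hx] with y hy hxy
  have hx := h.self_of_nhds
  rcases hxy with ⟨h1, h2⟩ | ⟨h1, h2⟩
  · left
    rw [hy.1 h2, hx.1 h1]
    exact ⟨h1, add_sub_add_right_eq_sub _ _ _⟩
  · right
    rw [hy.2 h2, hx.2 h1]
    exact ⟨h1, add_sub_add_right_eq_sub _ _ _⟩

theorem IsPiecewisePrimitiveAt.eventually_sub_eq_sub (h : IsPiecewisePrimitiveAt A B f g z x)
    (h' : IsPiecewisePrimitiveAt A B f g z' x)
    (hx : ∀ᶠ y in 𝓝 x, (x ∈ A ∧ y ∈ A) ∨ (x ∈ B ∧ y ∈ B)) :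
    ∀ᶠ y in 𝓝 x, z y - z' y = z x - z' x := by
  obtain ⟨c, c', h⟩ := h
  obtain ⟨e, e', h'⟩ := h'
  filter_upwards [h, h', hx] with y hy hy' hxy
  have hx := h.self_of_nhds
  have hx' := h'.self_of_nhds
  rcases hxy with ⟨h1, h2⟩ | ⟨h1, h2⟩
  · rw [hy.1 h2, hx.1 h1, hy'.1 h2, hx'.1 h1]
    abel
  · rw [hy.2 h2, hx.2 h1, hy'.2 h2, hx'.2 h1]
    abel

theorem IsPiecewisePrimitiveAt.congr_add (h : IsPiecewisePrimitiveAt A B f g z x)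
    (hz : ∀ᶠ y in 𝓝 x, z' y - z y = z' x - z x) : IsPiecewisePrimitiveAt A B f g z' x := by
  obtain ⟨c, c', h⟩ := h
  refine ⟨c + (z' x - z x), c' + (z' x - z x), ?_⟩
  filter_upwards [h, hz] with y hy hzy
  rw [← hzy]
  refine ⟨fun hA => ?_, fun hB => ?_⟩
  · rw [← add_assoc, ← hy.1 hA]; abel
  · rw [← add_assoc, ← hy.2 hB]; abel

open scoped Classical in
theorem isPiecewisePrimitiveAt_ite {c : F}
    (hc : ∀ᶠ y in 𝓝 x, y ∈ A → y ∈ B → f y - g y = c) :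
    IsPiecewisePrimitiveAt A B f g (fun y => if y ∈ A then f y else g y + c) x := by
  refine ⟨0, c, ?_⟩
  filter_upwards [hc] with y hy
  refine ⟨fun hA => by rw [if_pos hA, add_zero], fun hB => ?_⟩
  split_ifs with hA
  · rw [← hy hA hB]; abel
  · rfl

/-- Existence of a global piecewise primitive on a simply connected open set. -/
theorem exists_isPiecewisePrimitiveAt_of_simplyConnected [LocallyPathConnectedSpace X]
    {Ω : Set X} (hΩ : IsOpen Ω) [SimplyConnectedSpace Ω]
    (hAB : ∀ x ∈ Ω, ∀ᶠ y in 𝓝 x, (x ∈ A ∧ y ∈ A) ∨ (x ∈ B ∧ y ∈ B))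
    (hloc : ∀ x ∈ Ω, ∃ z, IsPiecewisePrimitiveAt A B f g z x) :
    ∃ z, ∀ x ∈ Ω, IsPiecewisePrimitiveAt A B f g z x := by
  have := hΩ.locallyPathConnectedSpace
  choose! s hs using hloc
  have hmap : ∀ (x : Ω) (P : X → Prop), (∀ᶠ y in 𝓝 x.1, P y) ↔ ∀ᶠ y : Ω in 𝓝 x, P y := by
    intro x P
    rw [← hΩ.isOpenEmbedding_subtypeVal.map_nhds_eq x, eventually_map]
  -- The chart of `i` is the open set of points where `s i` is a piecewise primitive; on overlaps
  -- two such maps differ by a locally constant one.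
  obtain ⟨z, hz⟩ := exists_glue_modulo_locally_constant
    (fun i : Ω => {x : Ω | IsPiecewisePrimitiveAt A B f g (s i) x})
    (fun i => isOpen_iff_eventually.2 fun x hx => (hmap x _).1 hx.eventually)
    (fun i => hs i i.2) (fun i x => s i x)
    (fun i j x hx => (hmap x fun y => s i y - s j y = s i x - s j x).1
      (hx.1.eventually_sub_eq_sub hx.2 (hAB x x.2)))
  classical
  refine ⟨fun x => if h : x ∈ Ω then z ⟨x, h⟩ else 0, fun x hx => ?_⟩
  refine (hs x hx).congr_add ?_
  rw [hmap ⟨x, hx⟩]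
  filter_upwards [hz ⟨x, hx⟩ ⟨x, hx⟩ (hs x hx)] with y hy
  simpa [hx] using hy

end LocalPrimitive

variable {d : ℕ} {Ω Ωp Ωm Γ : Set (Euc d)} {yp ym n z : Euc d → Euc d}

theorem eventually_mem_same_side (hΩp : IsOpen Ωp) (hΩm : IsOpen Ωm) (hΩ : IsOpen Ω)
    (hunion : Ω = Ωp ∪ Γ ∪ Ωm) {x : Euc d} (hx : x ∈ Ω) :
    ∀ᶠ y in 𝓝 x, (x ∈ Ωp ∪ Γ ∧ y ∈ Ωp ∪ Γ) ∨ (x ∈ Ωm ∪ Γ ∧ y ∈ Ωm ∪ Γ) := by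
  have hx' := hx
  rw [hunion] at hx'
  rcases hx' with (hx' | hx') | hx'
  · filter_upwards [hΩp.mem_nhds hx'] with y hy using Or.inl ⟨Or.inl hx', Or.inl hy⟩
  · filter_upwards [hΩ.mem_nhds hx] with y hy
    rw [hunion] at hy
    rcases hy with hy | hy
    exacts [Or.inl ⟨Or.inr hx', hy⟩, Or.inr ⟨Or.inr hx', Or.inl hy⟩]
  · filter_upwards [hΩm.mem_nhds hx'] with y hy using Or.inr ⟨Or.inl hx', Or.inl hy⟩

theorem JumpCondition.eventually_sub_eq (h : JumpCondition Γ yp ym n)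
    (hΓ : IsC1Surface Γ) (hΓp : Γ ⊆ closure Ωp) (hΓm : Γ ⊆ closure Ωm)
    (hyp : IsC1UpToBoundary Ωp yp) (hym : IsC1UpToBoundary Ωm ym)
    (hn : ∀ x ∈ Γ, ∀ v ∈ tangentConeAt ℝ Γ x, inner ℝ (n x) v = 0) {ξ : Euc d} (hξ : ξ ∈ Γ) :
    ∀ᶠ p in 𝓝 ξ, p ∈ Γ → yp p - ym p = yp ξ - ym ξ := by
  obtain ⟨a, -, ha⟩ := h
  have hdp : ∀ x ∈ Γ, DifferentiableAt ℝ yp x := fun x hx => hyp.differentiableAt (hΓp hx)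
  have hdm : ∀ x ∈ Γ, DifferentiableAt ℝ ym x := fun x hx => hym.differentiableAt (hΓm hx)
  refine hΓ.eventually_eq_of_tangential_fderiv_eq_zero (u := fun p => yp p - ym p)
    (fun x hx => (hdp x hx).sub (hdm x hx)) (fun x hx v hv => ?_) hξ
  rw [fderiv_fun_sub (hdp x hx) (hdm x hx), ha x hx, add_sub_cancel_left,
    InnerProductSpace.rankOne_apply, hn x hx v hv, zero_smul]

theorem exists_piecewise_primitive (hΩp : IsOpen Ωp) (hΩm : IsOpen Ωm) (hΩ : IsOpen Ω)
    (hdisj : Disjoint Ωp Ωm) (hunion : Ω = Ωp ∪ Γ ∪ Ωm)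
    (hΓp : Disjoint Ωp Γ) (hΓm : Disjoint Ωm Γ)
    (hloc : ∀ ξ ∈ Γ, ∀ᶠ p in 𝓝 ξ, p ∈ Γ → yp p - ym p = yp ξ - ym ξ)
    (hconn : IsPreconnected Γ ∨ SimplyConnectedSpace Ω) :
    ∃ z, ∀ x ∈ Ω, IsPiecewisePrimitiveAt (Ωp ∪ Γ) (Ωm ∪ Γ) yp ym z x := by
  classical
  have hinter : ∀ y, y ∈ Ωp ∪ Γ → y ∈ Ωm ∪ Γ → y ∈ Γ := by
    rintro y (h1 | h1) (h2 | h2)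
    exacts [(disjoint_left.1 hdisj h1 h2).elim, h2, h1, h1]
  rcases hconn with hconn | hconn
  -- A locally constant jump on a connected `Γ` is one constant, which serves at every point of `Ω`.
  · have hc : ∃ c, ∀ y ∈ Γ, yp y - ym y = c := by
      rcases Γ.eq_empty_or_nonempty with rfl | ⟨ξ, hξ⟩
      · exact ⟨0, by simp⟩
      have := isPreconnected_iff_preconnectedSpace.1 hconn
      have hlc : IsLocallyConstant fun y : Γ => yp y - ym y :=
        (IsLocallyConstant.iff_eventually_eq _).2 fun y => by
          filter_upwards [continuousAt_subtype_val.eventually (hloc y y.2)] with p hp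
          exact hp p.2
      exact ⟨yp ξ - ym ξ, fun y hy => hlc.apply_eq_of_preconnectedSpace ⟨y, hy⟩ ⟨ξ, hξ⟩⟩
    obtain ⟨c, hc⟩ := hc
    exact ⟨_, fun x _ => isPiecewisePrimitiveAt_ite (c := c)
      (Eventually.of_forall fun y h1 h2 => hc y (hinter y h1 h2))⟩
  · refine exists_isPiecewisePrimitiveAt_of_simplyConnected hΩ
      (fun x hx => eventually_mem_same_side hΩp hΩm hΩ hunion hx) fun x hx =>
        ⟨_, isPiecewisePrimitiveAt_ite (c := yp x - ym x) ?_⟩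
    rw [hunion] at hx
    rcases hx with (hx | hx) | hx
    · filter_upwards [hΩp.mem_nhds hx] with y hy h1 h2
      exact (disjoint_left.1 hΓp hy (hinter y h1 h2)).elim
    · filter_upwards [hloc x hx] with y hy h1 h2 using hy (hinter y h1 h2)
    · filter_upwards [hΩm.mem_nhds hx] with y hy h1 h2
      exact (disjoint_left.1 hΓm hy (hinter y h1 h2)).elim

theorem eventually_norm_sub_le_of_norm_fderiv_le {E F : Type*} [NormedAddCommGroup E]
    [NormedSpace ℝ E] [NormedAddCommGroup F] [NormedSpace ℝ F] {f : E → F} {x : E}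
    (hf : DifferentiableAt ℝ f x) {C : ℝ} (hC : ‖fderiv ℝ f x‖ ≤ C) :
    ∀ᶠ y in 𝓝 x, ‖f y - f x‖ ≤ (C + 1) * ‖y - x‖ := by
  filter_upwards [hf.hasFDerivAt.isLittleO.def one_pos] with y hy
  have h1 := norm_sub_norm_le (f y - f x) (fderiv ℝ f x (y - x))
  have h2 := ((fderiv ℝ f x).le_opNorm (y - x)).trans
    (mul_le_mul_of_nonneg_right hC (norm_nonneg _))
  linarith

theorem exists_eventually_norm_sub_le_of_primitive (hΩp : IsOpen Ωp) (hΩm : IsOpen Ωm)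
    (hΩ : IsOpen Ω) (hΩb : Bornology.IsBounded Ω) (hunion : Ω = Ωp ∪ Γ ∪ Ωm)
    (hΓp : Γ ⊆ closure Ωp) (hΓm : Γ ⊆ closure Ωm)
    (hyp : IsC1UpToBoundary Ωp yp) (hym : IsC1UpToBoundary Ωm ym)
    (hz : ∀ x ∈ Ω, IsPiecewisePrimitiveAt (Ωp ∪ Γ) (Ωm ∪ Γ) yp ym z x) :
    ∃ C, 0 ≤ C ∧ ∀ x ∈ Ω, ∀ᶠ y in 𝓝 x, ‖z y - z x‖ ≤ C * ‖y - x‖ := by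
  have hpΩ : Ωp ⊆ Ω := hunion ▸ subset_union_left.trans subset_union_left
  have hmΩ : Ωm ⊆ Ω := hunion ▸ subset_union_right
  obtain ⟨C, hC⟩ := hyp.exists_norm_fderiv_le (hΩb.subset hpΩ)
  obtain ⟨D, hD⟩ := hym.exists_norm_fderiv_le (hΩb.subset hmΩ)
  have hp : ∀ x ∈ Ωp ∪ Γ, ∀ᶠ y in 𝓝 x, ‖yp y - yp x‖ ≤ (C + 1) * ‖y - x‖ := fun x hx => by
    have hx : x ∈ closure Ωp := union_subset subset_closure hΓp hx
    exact eventually_norm_sub_le_of_norm_fderiv_le (hyp.differentiableAt hx) (hC x hx)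
  have hm : ∀ x ∈ Ωm ∪ Γ, ∀ᶠ y in 𝓝 x, ‖ym y - ym x‖ ≤ (D + 1) * ‖y - x‖ := fun x hx => by
    have hx : x ∈ closure Ωm := union_subset subset_closure hΓm hx
    exact eventually_norm_sub_le_of_norm_fderiv_le (hym.differentiableAt hx) (hD x hx)
  -- The outer maximum with 0 is needed because the bounds `C`, `D` carry no sign when a side is
  -- empty.
  refine ⟨max (max (C + 1) (D + 1)) 0, le_max_right _ _, fun x hx => ?_⟩
  have hp' : ∀ᶠ y in 𝓝 x, x ∈ Ωp ∪ Γ → ‖yp y - yp x‖ ≤ (C + 1) * ‖y - x‖ := by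
    by_cases h : x ∈ Ωp ∪ Γ
    · filter_upwards [hp x h] with y hy _ using hy
    · exact Eventually.of_forall fun y h' => (h h').elim
  have hm' : ∀ᶠ y in 𝓝 x, x ∈ Ωm ∪ Γ → ‖ym y - ym x‖ ≤ (D + 1) * ‖y - x‖ := by
    by_cases h : x ∈ Ωm ∪ Γ
    · filter_upwards [hm x h] with y hy _ using hy
    · exact Eventually.of_forall fun y h' => (h h').elim
  filter_upwards [hp', hm', (hz x hx).eventually_sub_eq
    (eventually_mem_same_side hΩp hΩm hΩ hunion hx)] with y h1 h2 h3
  rcases h3 with ⟨h4, h5⟩ | ⟨h4, h5⟩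
  · rw [h5]
    exact (h1 h4).trans (mul_le_mul_of_nonneg_right
      ((le_max_left _ _).trans (le_max_left _ _)) (norm_nonneg _))
  · rw [h5]
    exact (h2 h4).trans (mul_le_mul_of_nonneg_right
      ((le_max_right _ _).trans (le_max_left _ _)) (norm_nonneg _))

theorem ae_hasFDerivAt_of_primitive (hd : d ≠ 0) (hΩp : IsOpen Ωp) (hΩm : IsOpen Ωm)
    (hdisj : Disjoint Ωp Ωm) (hunion : Ω = Ωp ∪ Γ ∪ Ωm) (hΓ : IsC1Surface Γ)
    (hyp : IsC1UpToBoundary Ωp yp) (hym : IsC1UpToBoundary Ωm ym)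
    (hz : ∀ x ∈ Ω, IsPiecewisePrimitiveAt (Ωp ∪ Γ) (Ωm ∪ Γ) yp ym z x) :
    ∀ᵐ x ∂(volume.restrict Ω), HasFDerivAt z (piecewiseFDeriv Ωp Ωm yp ym x) x := by
  have hpΩ : Ωp ⊆ Ω := hunion ▸ subset_union_left.trans subset_union_left
  have hmΩ : Ωm ⊆ Ω := hunion ▸ subset_union_right
  rw [hunion, ae_restrict_union_eq, ae_restrict_union_eq, eventually_sup,
    eventually_sup, Measure.restrict_eq_zero.2 (hΓ.volume_eq_zero hd), ae_zero]
  refine ⟨⟨?_, eventually_bot⟩, ?_⟩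
  · filter_upwards [ae_restrict_mem hΩp.measurableSet] with x hx
    rw [piecewiseFDeriv_of_mem_left hdisj hx]
    obtain ⟨c, c', h⟩ := hz x (hpΩ hx)
    refine ((hyp.differentiableAt (subset_closure hx)).hasFDerivAt.add_const
      c).congr_of_eventuallyEq ?_
    filter_upwards [h, hΩp.mem_nhds hx] with y hy hyp using hy.1 (Or.inl hyp)
  · filter_upwards [ae_restrict_mem hΩm.measurableSet] with x hx
    rw [piecewiseFDeriv_of_mem_right hdisj hx]
    obtain ⟨c, c', h⟩ := hz x (hmΩ hx)
    refine ((hym.differentiableAt (subset_closure hx)).hasFDerivAt.add_const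
      c').congr_of_eventuallyEq ?_
    filter_upwards [h, hΩm.mem_nhds hx] with y hy hyp using hy.2 (Or.inl hyp)

end HadamardJump

end

theorem theorem3p1 (d : ℕ) (hd : 2 ≤ d)
    (Ω Ωp Ωm Γ : Set (HadamardJump.Euc d))
    (hΩ : HadamardJump.IsC1Domain Ω) (hΩb : Bornology.IsBounded Ω)
    (hΩp : IsOpen Ωp) (hΩm : IsOpen Ωm) (hdisj : Disjoint Ωp Ωm)
    (hunion : Ω = Ωp ∪ Γ ∪ Ωm)
    (hΓp : Γ = Ω ∩ frontier Ωp) (hΓm : Γ = Ω ∩ frontier Ωm)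
    (hΓ : HadamardJump.IsC1Surface Γ)
    (yp ym : HadamardJump.Euc d → HadamardJump.Euc d)
    (hyp : HadamardJump.IsC1UpToBoundary Ωp yp)
    (hym : HadamardJump.IsC1UpToBoundary Ωm ym)
    (n : HadamardJump.Euc d → HadamardJump.Euc d) (hnc : ContinuousOn n Γ)
    (hn : ∀ x ∈ Γ, HadamardJump.IsOutwardUnitNormal Ωp Γ x (n x)) :
    ((∃ z : HadamardJump.Euc d → HadamardJump.Euc d, HadamardJump.MemW1Infty Ω z ∧
        HadamardJump.WeakDerivPiecewise Ω Ωp Ωm yp ym z) →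
      HadamardJump.JumpCondition Γ yp ym n) ∧
    ((IsPreconnected Γ ∨ SimplyConnectedSpace Ω) →
      HadamardJump.JumpCondition Γ yp ym n →
      ∃ z : HadamardJump.Euc d → HadamardJump.Euc d, HadamardJump.MemW1Infty Ω z ∧
        HadamardJump.WeakDerivPiecewise Ω Ωp Ωm yp ym z) := by
  have hd0 : d ≠ 0 := by omega
  have hΓp' : Γ ⊆ frontier Ωp := hΓp.subset.trans inter_subset_right
  have hΓm' : Γ ⊆ frontier Ωm := hΓm.subset.trans inter_subset_right
  have hclp : Γ ⊆ closure Ωp := hΓp'.trans frontier_subset_closure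
  have hclm : Γ ⊆ closure Ωm := hΓm'.trans frontier_subset_closure
  have hdf : ∀ {U : Set (HadamardJump.Euc d)}, IsOpen U → Γ ⊆ frontier U → Disjoint U Γ :=
    fun hU h => (disjoint_frontier_iff_isOpen.2 hU).symm.mono_right h
  refine ⟨?_, fun hconn hjump => ?_⟩
  · rintro ⟨z, -, hz⟩
    exact HadamardJump.jumpCondition_of_tangential_eq hclp hclm hyp hym hnc
      (fun x hx => (hn x hx).norm_eq_one) fun x hx w hw =>
        HadamardJump.fderiv_apply_eq_of_weakDerivPiecewise hd0 hΩ.isOpen hΩb hΩp hΩm hdisj hunion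
          hclp hclm hΓ hyp hym hx (hn x hx) hz hw
  · have hpΩ : Ωp ⊆ Ω := hunion ▸ subset_union_left.trans subset_union_left
    have hmΩ : Ωm ⊆ Ω := hunion ▸ subset_union_right
    obtain ⟨z, hz⟩ := HadamardJump.exists_piecewise_primitive hΩp hΩm hΩ.isOpen hdisj hunion
      (hdf hΩp hΓp') (hdf hΩm hΓm')
      (fun ξ hξ => hjump.eventually_sub_eq hΓ hclp hclm hyp hym
        (fun x hx => (hn x hx).orthogonal) hξ) hconn
    obtain ⟨C, hC, hzC⟩ := HadamardJump.exists_eventually_norm_sub_le_of_primitive hΩp hΩm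
      hΩ.isOpen hΩb hunion hclp hclm hyp hym hz
    obtain ⟨M, hM⟩ := hΩ.exists_bound_of_eventually_norm_sub_le hΩb hzC
    obtain ⟨D, hD⟩ := HadamardJump.exists_norm_piecewiseFDeriv_le hyp hym (hΩb.subset hpΩ)
      (hΩb.subset hmΩ)
    have hG := HadamardJump.stronglyMeasurable_piecewiseFDeriv (yp := yp) (ym := ym) hΩp hΩm
    have hweak := HadamardJump.hasWeakDeriv_of_eventually_norm_sub_le hΩ.isOpen hΩb hC hzC hG hD
      (HadamardJump.ae_hasFDerivAt_of_primitive hd0 hΩp hΩm hdisj hunion hΓ hyp hym hz)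
    have hcont : ContinuousOn z Ω := fun x hx =>
      (HadamardJump.continuousAt_of_eventually_norm_sub_le (hzC x hx)).continuousWithinAt
    -- The same bounded field `piecewiseFDeriv` witnesses both the Sobolev membership and the
    -- prescribed gradient.
    refine ⟨z, ⟨memLp_top_of_bound (hcont.aestronglyMeasurable hΩ.isOpen.measurableSet) M
        ((ae_restrict_mem hΩ.isOpen.measurableSet).mono hM),
      _, memLp_top_of_bound hG.aestronglyMeasurable D (Eventually.of_forall hD), hweak⟩,
      _, hweak, ?_, ?_⟩
    · filter_upwards [ae_restrict_mem hΩp.measurableSet] with x hx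
        using HadamardJump.piecewiseFDeriv_of_mem_left hdisj hx
    · filter_upwards [ae_restrict_mem hΩm.measurableSet] with x hx
        using HadamardJump.piecewiseFDeriv_of_mem_right hdisj hx
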